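/- Consider $n$ jobs with processing times $p_1,\dots,p_n>0$, two identical parallel machines, and a uniform setup time $s>0$. A feasible schedule splits each job into finitely many parts of positive length whose lengths add up to its processing time. Each part is assigned to a machine and a start time $\ge 0$; a part of length $x$ that starts at time $r$ occupies its machine during $[r,r+s+x)$ (first a setup of length $s$, then the processing) and finishes at time $r+s+x$. A machine is occupied by at most one part at a time, while parts of the same job on different machines may be processed simultaneously. The completion time $C_j$ of job $j$ is the largest finishing time of its parts, and the objective is to minimise the total completion time $\sum_{j=1}^n C_j$. There exists an algorithm that, for every $n$ and every such instance $(p_1,\dots,p_n,s)$, given in arbitrary order, computes a feasible schedule (the list of all parts, with job, machine, start time and length of each) minimising the total completion time over all feasible schedules, and whose running time on every instance with $n$ jobs is at most $T(n)$ with $T(n)=O(n\log n)$. Here the algorithm is one fixed program, not depending on $n$, for a unit-cost random access machine that handles natural numbers (counters and addresses) and real numbers, with finitely many registers and arrays, indirect addressing, addition and subtraction, halving of real numbers, and comparisons; each executed instruction or test counts as one step. -/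

import Mathlib

namespace SplitScheduling

/-! Schedules with job splitting and a uniform setup time. -/

/-- A part of one of `n` jobs on one of `m` machines. The part occupies its machine from `start` on:
first the setup is done, then `length` units of the job are processed. -/
structure Part (n m : ℕ) where
  job : Fin n
  machine : Fin m
  start : ℝ
  length : ℝ

/-- The time at which a part is finished, when the setup time is `s`. -/
def Part.finish {n m : ℕ} (a : Part n m) (s : ℝ) : ℝ := a.start + s + a.length

/-- A finite family of job parts. -/
structure Schedule (n m : ℕ) where
  numParts : ℕ
  part : Fin numParts → Part n m

namespace Schedule

variable {n m : ℕ}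

/-- Feasibility for processing times `p` and setup time `s`. The parts of a job on different
machines may be processed simultaneously. -/
structure IsFeasible (S : Schedule n m) (p : Fin n → ℝ) (s : ℝ) : Prop where
  start_nonneg : ∀ a, 0 ≤ (S.part a).start
  length_pos : ∀ a, 0 < (S.part a).length
  /-- A machine sets up or processes at most one part at a time. -/
  no_overlap : ∀ a b, a ≠ b → (S.part a).machine = (S.part b).machine →
    (S.part a).finish s ≤ (S.part b).start ∨ (S.part b).finish s ≤ (S.part a).start
  /-- Every job is processed completely. -/
  complete : ∀ j, ∑ a with (S.part a).job = j, (S.part a).length = p j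

/-- The completion time of job `j`: the largest finishing time of its parts. -/
noncomputable def completionTime (S : Schedule n m) (s : ℝ) (j : Fin n) : ℝ :=
  ⨆ a : {a : Fin S.numParts // (S.part a).job = j}, (S.part a).finish s

noncomputable def totalCompletionTime (S : Schedule n m) (s : ℝ) : ℝ :=
  ∑ j, S.completionTime s j

/-- A feasible schedule of minimum total completion time among all feasible schedules. -/
def IsOptimal (S : Schedule n m) (p : Fin n → ℝ) (s : ℝ) : Prop :=
  S.IsFeasible p s ∧
    ∀ S' : Schedule n m, S'.IsFeasible p s → S.totalCompletionTime s ≤ S'.totalCompletionTime s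

end Schedule

/-! A random access machine with unit costs, working on natural numbers (used as counters and
addresses) and on real numbers. Programs are structured and use finitely many registers and arrays.
The only arithmetic is addition, subtraction, and halving of reals. -/

/-- The memory: registers and arrays of natural numbers, registers and arrays of reals.
The array named `A` has the entries `natArr A 0, natArr A 1, …`, likewise for reals. -/
structure State where
  natReg : ℕ → ℕ
  realReg : ℕ → ℝ
  natArr : ℕ → ℕ → ℕ
  realArr : ℕ → ℕ → ℝ

/-- Instructions. The arguments `a b c i` are register names, `A` is an array name. -/
inductive Instr where
  /-- natural register `a` gets the constant `k` -/
  | natConst (a k : ℕ)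
  /-- natural register `a` gets the sum of the natural registers `b` and `c` -/
  | natAdd (a b c : ℕ)
  /-- natural register `a` gets the truncated difference of the natural registers `b` and `c` -/
  | natSub (a b c : ℕ)
  /-- natural register `a` gets entry `natReg i` of natural array `A` -/
  | natRead (a A i : ℕ)
  /-- entry `natReg i` of natural array `A` gets natural register `a` -/
  | natWrite (A i a : ℕ)
  /-- real register `a` gets the sum of the real registers `b` and `c` -/
  | realAdd (a b c : ℕ)
  /-- real register `a` gets the difference of the real registers `b` and `c` -/
  | realSub (a b c : ℕ)
  /-- real register `a` gets half of the real register `b` -/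
  | realHalf (a b : ℕ)
  /-- real register `a` gets entry `natReg i` of real array `A` -/
  | realRead (a A i : ℕ)
  /-- entry `natReg i` of real array `A` gets real register `a` -/
  | realWrite (A i a : ℕ)

open Function in
/-- The effect of an instruction. -/
noncomputable def Instr.apply : Instr → State → State
  | natConst a k, σ => { σ with natReg := update σ.natReg a k }
  | natAdd a b c, σ => { σ with natReg := update σ.natReg a (σ.natReg b + σ.natReg c) }
  | natSub a b c, σ => { σ with natReg := update σ.natReg a (σ.natReg b - σ.natReg c) }
  | natRead a A i, σ => { σ with natReg := update σ.natReg a (σ.natArr A (σ.natReg i)) }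
  | natWrite A i a, σ =>
      { σ with natArr := update σ.natArr A (update (σ.natArr A) (σ.natReg i) (σ.natReg a)) }
  | realAdd a b c, σ => { σ with realReg := update σ.realReg a (σ.realReg b + σ.realReg c) }
  | realSub a b c, σ => { σ with realReg := update σ.realReg a (σ.realReg b - σ.realReg c) }
  | realHalf a b, σ => { σ with realReg := update σ.realReg a (σ.realReg b / 2) }
  | realRead a A i, σ => { σ with realReg := update σ.realReg a (σ.realArr A (σ.natReg i)) }
  | realWrite A i a, σ =>
      { σ with realArr := update σ.realArr A (update (σ.realArr A) (σ.natReg i) (σ.realReg a)) }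

/-- Tests: comparison of two natural or of two real registers. -/
inductive Test where
  | natLt (a b : ℕ)
  | realLt (a b : ℕ)

def Test.Holds : Test → State → Prop
  | natLt a b, σ => σ.natReg a < σ.natReg b
  | realLt a b, σ => σ.realReg a < σ.realReg b

inductive Program where
  | skip
  | instr (i : Instr)
  | seq (c d : Program)
  | ite (b : Test) (c d : Program)
  | while (b : Test) (c : Program)

/-- `Exec c σ t τ`: started in memory state `σ`, the program `c` halts after exactly `t` steps in
memory state `τ`. Every executed instruction and every evaluated test counts as one step. -/
inductive Exec : Program → State → ℕ → State → Prop where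
  | skip (σ : State) : Exec .skip σ 1 σ
  | instr (i : Instr) (σ : State) : Exec (.instr i) σ 1 (i.apply σ)
  | seq {c d : Program} {σ τ υ : State} {t u : ℕ} :
      Exec c σ t τ → Exec d τ u υ → Exec (.seq c d) σ (t + u) υ
  | ite_true {b : Test} {c d : Program} {σ τ : State} {t : ℕ} :
      b.Holds σ → Exec c σ t τ → Exec (.ite b c d) σ (t + 1) τ
  | ite_false {b : Test} {c d : Program} {σ τ : State} {t : ℕ} :
      ¬ b.Holds σ → Exec d σ t τ → Exec (.ite b c d) σ (t + 1) τ
  | while_true {b : Test} {c : Program} {σ τ υ : State} {t u : ℕ} :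
      b.Holds σ → Exec c σ t τ → Exec (.while b c) τ u υ → Exec (.while b c) σ (t + u + 1) υ
  | while_false {b : Test} {c : Program} {σ : State} :
      ¬ b.Holds σ → Exec (.while b c) σ 1 σ

/-- The initial memory: the number of jobs is in natural register `0`, the setup time is in real
register `0`, the processing times are the first `n` entries of real array `0`, in the given order;
everything else is `0`. -/
noncomputable def inputState {n : ℕ} (p : Fin n → ℝ) (s : ℝ) : State where
  natReg := Function.update (fun _ => 0) 0 n
  realReg := Function.update (fun _ => 0) 0 s
  natArr := fun _ _ => 0
  realArr := Function.update (fun _ _ => 0) 0 (fun i => if h : i < n then p ⟨i, h⟩ else 0)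

/-- The memory state `σ` holds the schedule `S` as output: the number of parts is in natural
register `0`, and for each part the index of its job, its machine, its start and its length are in
the natural arrays `0`, `1` and the real arrays `1`, `2`, respectively. -/
structure Outputs {n m : ℕ} (σ : State) (S : Schedule n m) : Prop where
  numParts : σ.natReg 0 = S.numParts
  job : ∀ a : Fin S.numParts, σ.natArr 0 a = (S.part a).job
  machine : ∀ a : Fin S.numParts, σ.natArr 1 a = (S.part a).machine
  start : ∀ a : Fin S.numParts, σ.realArr 1 a = (S.part a).start
  length : ∀ a : Fin S.numParts, σ.realArr 2 a = (S.part a).length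

end SplitScheduling

/-! Let `q 0 ≤ q 1 ≤ …` be the processing times in sorted order, each increased by the setup time
`s`. For some threshold `K` the following schedule is optimal. The jobs are taken in sorted order.
Each of the first `K` is put whole on the machine that is free first. A later job is cut in two so
that both machines become free simultaneously, or kept whole if its processing time fits into the
gap between the machines. Twice the cost is at most `∑ (n - k) * q k + altSum q (K + 1) + ∑_{k ≥ K}
s * (n - k)`. The middle term adds up the gaps between the machines after the unsplit jobs. The last
one charges an extra setup to every job from position `k` on (`PartialPlan.unsplit`,
`PartialPlan.split`).

Every feasible schedule costs at least half of this expression for some `K`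
(`exists_le_two_mul_totalCompletionTime`). Order its jobs by completion time, let `c k` be the time
when the first `k` are finished, and let `D k` be `2 * c k` minus their work, where a job with
several parts is charged one extra setup. Two machines work until `c k`, so `D k ≥ 0`. If the next
job is unsplit, only its machine is needed after `c k`, and this gives `D k + D (k + 1) ≥ r k` for
its time `r k`. Pairing these inequalities from the last job downwards bounds `∑ D` plus the setup
penalties by a constant plus a sum of `r k` with weights in `{0, 1}` (`exists_weights`). Neither
depends on job lengths, so the rearrangement inequality replaces `r` by the sorted `q`
(`sum_weights_le`); only then is `K` chosen.

The program sorts by bottom-up merging, computes the expression for every `K` in one linear sweep,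
and places the jobs for the best `K`. Sorting dominates the running time; `movesLeft` is the
potential that accounts for it. -/

namespace SplitScheduling

/-! ### Reasoning about programs -/

/-- Started in `σ`, the program `c` halts within `T` steps in a state satisfying `Q`. -/
def Runs (c : Program) (σ : State) (T : ℕ) (Q : State → Prop) : Prop :=
  ∃ t τ, t ≤ T ∧ Exec c σ t τ ∧ Q τ

/-- A straight-line program. -/
def block : List Instr → Program
  | [] => .skip
  | i :: l => .seq (.instr i) (block l)

/-- The effect of a straight-line program. -/
noncomputable def applyAll : List Instr → State → State
  | [], σ => σ
  | i :: l, σ => applyAll l (i.apply σ)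

theorem exec_block (l : List Instr) (σ : State) :
    Exec (block l) σ (l.length + 1) (applyAll l σ) := by
  induction l generalizing σ with
  | nil => exact Exec.skip σ
  | cons i l ih =>
    have h := Exec.seq (Exec.instr i σ) (ih (i.apply σ))
    rw [List.length_cons, Nat.add_comm l.length 1, Nat.add_assoc]
    exact h

namespace Runs

variable {c d : Program} {b : Test} {σ : State} {T U : ℕ} {Q R : State → Prop}

theorem mono (h : Runs c σ T Q) (hT : T ≤ U) (hQ : ∀ τ, Q τ → R τ) : Runs c σ U R := by
  obtain ⟨t, τ, ht, he, hq⟩ := h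
  exact ⟨t, τ, ht.trans hT, he, hQ τ hq⟩

theorem of_block {l : List Instr} (hQ : Q (applyAll l σ)) (hT : l.length + 1 ≤ T) :
    Runs (block l) σ T Q :=
  ⟨_, _, hT, exec_block l σ, hQ⟩

theorem seq (h : Runs c σ T fun τ => Runs d τ U Q) : Runs (.seq c d) σ (T + U) Q := by
  obtain ⟨t, τ, ht, he, u, υ, hu, hf, hq⟩ := h
  exact ⟨t + u, υ, Nat.add_le_add ht hu, .seq he hf, hq⟩

theorem block_seq {l : List Instr} (hT : l.length + 1 + T ≤ U)
    (h : Runs c (applyAll l σ) T Q) : Runs (.seq (block l) c) σ U Q :=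
  (seq (of_block (Q := fun τ => Runs c τ T Q) h le_rfl)).mono hT fun _ => id

theorem ite (h₁ : b.Holds σ → Runs c σ T Q) (h₂ : ¬ b.Holds σ → Runs d σ T Q) :
    Runs (.ite b c d) σ (T + 1) Q := by
  by_cases hb : b.Holds σ
  · obtain ⟨t, τ, ht, he, hq⟩ := h₁ hb
    exact ⟨t + 1, τ, by omega, .ite_true hb he, hq⟩
  · obtain ⟨t, τ, ht, he, hq⟩ := h₂ hb
    exact ⟨t + 1, τ, by omega, .ite_false hb he, hq⟩

/-- The loop rule, with an invariant `I` and a potential `Φ` that pays for the steps. -/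
theorem loop (I : State → Prop) (Φ : State → ℕ) (hσ : I σ) (hT : Φ σ + 1 ≤ T)
    (step : ∀ σ, I σ → b.Holds σ → ∃ t, Runs c σ t fun τ => I τ ∧ t + 1 + Φ τ ≤ Φ σ) :
    Runs (.while b c) σ T fun τ => I τ ∧ ¬ b.Holds τ := by
  suffices ∀ k σ, Φ σ = k → I σ →
      Runs (.while b c) σ (k + 1) fun τ => I τ ∧ ¬ b.Holds τ from
    (this _ σ rfl hσ).mono hT fun _ => id
  intro k
  induction k using Nat.strong_induction_on with
  | _ k ih =>
    intro σ hk hI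
    by_cases hb : b.Holds σ
    · obtain ⟨t, t', τ, ht, he, hIτ, hΦ⟩ := step σ hI hb
      obtain ⟨u, υ, hu, hf, hq⟩ := ih (Φ τ) (by omega) τ rfl hIτ
      exact ⟨t' + u + 1, υ, by omega, .while_true hb he hf, hq⟩
    · exact ⟨1, σ, by omega, .while_false hb, hI, hb⟩

end Runs

/-! ### Array segments -/

/-- The entries `V a, …, V (b - 1)`. -/
def seg (V : ℕ → ℕ) (a b : ℕ) : List ℕ := (List.range' a (b - a)).map V

section seg

variable {V : ℕ → ℕ} {a b c : ℕ}

theorem seg_self : seg V a a = [] := by simp [seg]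

theorem length_seg : (seg V a b).length = b - a := by simp [seg]

theorem seg_of_lt (h : a < b) : seg V a b = V a :: seg V (a + 1) b := by
  obtain ⟨k, rfl⟩ := Nat.exists_eq_add_of_lt h
  simp only [seg]
  rw [show a + k + 1 - a = k + 1 by omega, show a + k + 1 - (a + 1) = k by omega]
  rfl

theorem seg_append (h₁ : a ≤ b) (h₂ : b ≤ c) : seg V a b ++ seg V b c = seg V a c := by
  obtain ⟨k, rfl⟩ := Nat.exists_eq_add_of_le h₁
  obtain ⟨l, rfl⟩ := Nat.exists_eq_add_of_le h₂
  simp only [seg, Nat.add_sub_cancel_left, ← List.map_append]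
  rw [Nat.add_assoc, Nat.add_sub_cancel_left, List.range'_append_1]

theorem seg_congr {W : ℕ → ℕ} (h : ∀ k, a ≤ k → k < b → V k = W k) : seg V a b = seg W a b := by
  apply List.map_congr_left
  intro k hk
  rw [List.mem_range'_1] at hk
  exact h k hk.1 (by omega)

theorem seg_update_of_le {o v : ℕ} (h : b ≤ o) :
    seg (Function.update V o v) a b = seg V a b :=
  seg_congr fun k _ hk => Function.update_of_ne (by omega) _ _

theorem seg_update_succ {o v : ℕ} (h : a ≤ o) :
    seg (Function.update V o v) a (o + 1) = seg V a o ++ [v] := by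
  rw [← seg_append h (Nat.le_succ o), seg_update_of_le le_rfl, seg_of_lt (Nat.lt_succ_self o),
    seg_self, Function.update_self]

end seg

/-! ### Sorting -/

/-- The order used for merging. -/
noncomputable def keyLe (f : ℕ → ℝ) (x y : ℕ) : Bool := decide (f x ≤ f y)

def KeySorted (f : ℕ → ℝ) (l : List ℕ) : Prop := l.Pairwise fun x y => f x ≤ f y

theorem KeySorted.merge {f : ℕ → ℝ} {l₁ l₂ : List ℕ} (h₁ : KeySorted f l₁) (h₂ : KeySorted f l₂) :
    KeySorted f (List.merge l₁ l₂ (keyLe f)) := by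
  have := List.pairwise_merge (le := keyLe f)
    (by simp only [keyLe, decide_eq_true_eq]; exact fun a b c => le_trans)
    (by simp only [keyLe, Bool.or_eq_true, decide_eq_true_eq]; exact fun a b => le_total _ _)
    l₁ l₂ (by simpa [keyLe, KeySorted] using h₁) (by simpa [keyLe, KeySorted] using h₂)
  simpa [keyLe, KeySorted] using this

/-- Moves the next element of the run read through natural register `i`. -/
def moveNext (i : ℕ) : Program :=
  block [.natRead 13 2 i, .natWrite 2 8 13, .natAdd i i 1, .natAdd 8 8 1]

/-- Merges the runs `[reg 4, reg 6)` and `[reg 5, reg 7)` into `[reg 8, reg 12)`. -/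
def mergeLoop : Program :=
  .while (.natLt 8 12)
    (.ite (.natLt 4 6)
      (.ite (.natLt 5 7)
        (.seq (block [.natRead 13 2 4, .natRead 14 2 5, .realRead 2 0 13, .realRead 3 0 14])
          (.ite (.realLt 3 2) (moveNext 5) (moveNext 4)))
        (moveNext 4))
      (moveNext 5))

/-- The invariant of `mergeLoop`, started in `σ₀`, with `R` the merged list. -/
structure MergeInv (σ₀ : State) (R : List ℕ) (σ : State) : Prop where
  reg : ∀ r, r ≠ 4 → r ≠ 5 → r ≠ 8 → r ≠ 13 → r ≠ 14 → σ.natReg r = σ₀.natReg r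
  real0 : σ.realReg 0 = σ₀.realReg 0
  real1 : σ.realReg 1 = σ₀.realReg 1
  realHigh : ∀ r, 4 ≤ r → σ.realReg r = σ₀.realReg r
  arr : ∀ A, A ≠ 2 → σ.natArr A = σ₀.natArr A
  realArr : σ.realArr = σ₀.realArr
  old : ∀ k < σ₀.natReg 8, σ.natArr 2 k = σ₀.natArr 2 k
  le4 : σ.natReg 4 ≤ σ.natReg 6
  le5 : σ.natReg 5 ≤ σ.natReg 7
  le6 : σ.natReg 6 ≤ σ₀.natReg 8
  le7 : σ.natReg 7 ≤ σ₀.natReg 8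
  le8 : σ₀.natReg 8 ≤ σ.natReg 8
  count : σ.natReg 8 + (σ.natReg 6 - σ.natReg 4) + (σ.natReg 7 - σ.natReg 5) = σ.natReg 12
  one : σ.natReg 1 = 1
  merged : seg (σ.natArr 2) (σ₀.natReg 8) (σ.natReg 8) ++
    List.merge (seg (σ.natArr 2) (σ.natReg 4) (σ.natReg 6))
      (seg (σ.natArr 2) (σ.natReg 5) (σ.natReg 7)) (keyLe (σ.realArr 0)) = R

theorem moveNext_spec {i : ℕ} {σ : State} {Q : State → Prop}
    (hi : i = 4 ∨ i = 5) (h1 : σ.natReg 1 = 1)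
    (hQ : Q { σ with
      natReg := Function.update (Function.update (Function.update σ.natReg 13
        (σ.natArr 2 (σ.natReg i))) i (σ.natReg i + 1)) 8 (σ.natReg 8 + 1)
      natArr := Function.update σ.natArr 2
        (Function.update (σ.natArr 2) (σ.natReg 8) (σ.natArr 2 (σ.natReg i))) }) :
    Runs (moveNext i) σ 5 Q := by
  refine Runs.of_block ?_ (by simp)
  rcases hi with rfl | rfl <;>
    simpa [applyAll, Instr.apply, Function.update_apply, h1] using hQ

/-- Treats both runs at once: `i` is the read pointer and `ei` the end of the run that supplies the
element. The comparison of heads enters only through `hR`. -/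
theorem MergeInv.move {σ₀ σ : State} {R : List ℕ} (h : MergeInv σ₀ R σ) {i j ei ej : ℕ}
    (hij : i = 4 ∧ j = 5 ∧ ei = 6 ∧ ej = 7 ∨ i = 5 ∧ j = 4 ∧ ei = 7 ∧ ej = 6)
    (hlt : σ.natReg i < σ.natReg ei)
    (hR : List.merge (seg (σ.natArr 2) (σ.natReg 4) (σ.natReg 6))
      (seg (σ.natArr 2) (σ.natReg 5) (σ.natReg 7)) (keyLe (σ.realArr 0)) =
      σ.natArr 2 (σ.natReg i) ::
        List.merge (seg (σ.natArr 2) (σ.natReg 4 + if i = 4 then 1 else 0) (σ.natReg 6))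
          (seg (σ.natArr 2) (σ.natReg 5 + if i = 5 then 1 else 0) (σ.natReg 7))
          (keyLe (σ.realArr 0))) :
    Runs (moveNext i) σ 5 fun τ => MergeInv σ₀ R τ ∧ τ.natReg 8 = σ.natReg 8 + 1 ∧
      τ.natReg 12 = σ.natReg 12 := by
  obtain ⟨a1, a2, a3, a4, a5, a6, a7, a8, a9, a10, a11, a12, a13, a14, a15⟩ := h
  rw [hR] at a15
  apply moveNext_spec (by omega) a14
  rcases hij with ⟨rfl, rfl, rfl, rfl⟩ | ⟨rfl, rfl, rfl, rfl⟩
  all_goals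
    refine ⟨⟨?_, a2, a3, a4, ?_, a6, ?_, ?_, ?_, ?_, ?_, ?_, ?_, ?_, ?_⟩, ?_, ?_⟩
    all_goals try (simp [Function.update_apply] <;> omega)
    · intro r h4 h5 h8 h13 h14
      simp [h4, h5, h8, h13, a1 r h4 h5 h8 h13 h14]
    · intro A hA
      simp [hA, a5 A hA]
    · intro k hk
      simp [show k ≠ σ.natReg 8 by omega, a7 k hk]
    · simp only [Function.update_apply, reduceIte, Nat.reduceEqDiff] at a15 ⊢
      rw [seg_update_succ a12, seg_update_of_le (by omega), seg_update_of_le (by omega)]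
      simpa using a15

/-- The output is appended behind both runs, so writing never destroys unread elements. One round
costs at most 13 steps and a loop test, hence 14 per element. -/
theorem mergeLoop_spec {σ : State} {T : ℕ}
    (h46 : σ.natReg 4 ≤ σ.natReg 6) (h65 : σ.natReg 6 = σ.natReg 5)
    (h57 : σ.natReg 5 ≤ σ.natReg 7) (h78 : σ.natReg 7 ≤ σ.natReg 8)
    (h12 : σ.natReg 12 = σ.natReg 8 + (σ.natReg 7 - σ.natReg 4)) (h1 : σ.natReg 1 = 1)
    (hT : 14 * (σ.natReg 7 - σ.natReg 4) + 1 ≤ T) :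
    Runs mergeLoop σ T fun τ =>
      MergeInv σ (List.merge (seg (σ.natArr 2) (σ.natReg 4) (σ.natReg 6))
        (seg (σ.natArr 2) (σ.natReg 6) (σ.natReg 7)) (keyLe (σ.realArr 0))) τ ∧
      seg (τ.natArr 2) (σ.natReg 8) (τ.natReg 8) =
        List.merge (seg (σ.natArr 2) (σ.natReg 4) (σ.natReg 6))
        (seg (σ.natArr 2) (σ.natReg 6) (σ.natReg 7)) (keyLe (σ.realArr 0)) ∧
      τ.natReg 8 = σ.natReg 8 + (σ.natReg 7 - σ.natReg 4) := by
  set R := List.merge (seg (σ.natArr 2) (σ.natReg 4) (σ.natReg 6))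
        (seg (σ.natArr 2) (σ.natReg 6) (σ.natReg 7)) (keyLe (σ.realArr 0)) with hR
  refine (Runs.loop (MergeInv σ R) (fun τ => 14 * (τ.natReg 12 - τ.natReg 8)) ?_ ?_ ?_).mono le_rfl
    ?_
  · refine ⟨fun _ _ _ _ _ _ => rfl, rfl, rfl, fun _ _ => rfl, fun _ _ => rfl, rfl, fun _ _ => rfl,
      h46, h57, by omega, h78, le_rfl, by omega, h1, ?_⟩
    rw [seg_self, hR, h65, List.nil_append]
  · show 14 * (σ.natReg 12 - σ.natReg 8) + 1 ≤ T
    omega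
  · intro τ hI hb
    have hb' : τ.natReg 8 < τ.natReg 12 := hb
    have hcount := hI.count
    have fin : ∀ υ, MergeInv σ R υ ∧ υ.natReg 8 = τ.natReg 8 + 1 ∧
        υ.natReg 12 = τ.natReg 12 → MergeInv σ R υ ∧
        13 + 1 + 14 * (υ.natReg 12 - υ.natReg 8) ≤ 14 * (τ.natReg 12 - τ.natReg 8) :=
      fun υ h => ⟨h.1, by omega⟩
    refine ⟨13, ?_⟩
    refine Runs.ite (T := 12) (fun h4 => ?_) fun h4 => ?_
    · refine Runs.ite (T := 11) (fun h5 => ?_) fun h5 => ?_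
      · have h4' : τ.natReg 4 < τ.natReg 6 := h4
        have h5' : τ.natReg 5 < τ.natReg 7 := h5
        refine Runs.block_seq (T := 6) (by simp) ?_
        set υ := applyAll [.natRead 13 2 4, .natRead 14 2 5, .realRead 2 0 13, .realRead 3 0 14] τ
          with hυ
        have hυ4 : υ.natReg 4 = τ.natReg 4 := by simp [hυ, applyAll, Instr.apply]
        have hυ5 : υ.natReg 5 = τ.natReg 5 := by simp [hυ, applyAll, Instr.apply]
        have hυ6 : υ.natReg 6 = τ.natReg 6 := by simp [hυ, applyAll, Instr.apply]
        have hυ7 : υ.natReg 7 = τ.natReg 7 := by simp [hυ, applyAll, Instr.apply]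
        have hυ8 : υ.natReg 8 = τ.natReg 8 := by simp [hυ, applyAll, Instr.apply]
        have hυ12 : υ.natReg 12 = τ.natReg 12 := by simp [hυ, applyAll, Instr.apply]
        have hυV : υ.natArr = τ.natArr := by simp [hυ, applyAll, Instr.apply]
        have hυR : υ.realArr = τ.realArr := by simp [hυ, applyAll, Instr.apply]
        have hυ2 : υ.realReg 2 = τ.realArr 0 (τ.natArr 2 (τ.natReg 4)) := by
          simp [hυ, applyAll, Instr.apply]
        have hυ3 : υ.realReg 3 = τ.realArr 0 (τ.natArr 2 (τ.natReg 5)) := by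
          simp [hυ, applyAll, Instr.apply]
        have hI' : MergeInv σ R υ := by
          obtain ⟨a1, a2, a3, a4, a5, a6, a7, a8, a9, a10, a11, a12, a13, a14, a15⟩ := hI
          refine ⟨?_, ?_, ?_, ?_, ?_, ?_, ?_, ?_, ?_, ?_, ?_, ?_, ?_, ?_, ?_⟩
          · intro r h4 h5 h8 h13 h14
            rw [← a1 r h4 h5 h8 h13 h14]
            simp [hυ, applyAll, Instr.apply, h13, h14]
          · rw [← a2]; simp [hυ, applyAll, Instr.apply]
          · rw [← a3]; simp [hυ, applyAll, Instr.apply]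
          · intro r hr
            rw [← a4 r hr]
            simp [hυ, applyAll, Instr.apply, show r ≠ 2 by omega, show r ≠ 3 by omega]
          · rwa [hυV]
          · rwa [hυR]
          · rwa [hυV]
          · rwa [hυ4, hυ6]
          · rwa [hυ5, hυ7]
          · rwa [hυ6]
          · rwa [hυ7]
          · rwa [hυ8]
          · rwa [hυ8, hυ6, hυ4, hυ7, hυ5, hυ12]
          · simpa [hυ, applyAll, Instr.apply] using a14
          · rwa [hυ8, hυ6, hυ4, hυ7, hυ5, hυV, hυR]
        rw [← hυ8, ← hυ12] at fin
        refine Runs.ite (T := 5) (fun h => ?_) fun h => ?_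
        · refine (hI'.move (i := 5) (j := 4) (ei := 7) (ej := 6) (by simp) (by omega) ?_).mono le_rfl (by rwa [hυ8, hυ12] at fin ⊢)
          have h' : υ.realReg 3 < υ.realReg 2 := h
          rw [hυ2, hυ3] at h'
          rw [hυ4, hυ5, hυ6, hυ7, hυV, hυR, seg_of_lt h4', seg_of_lt h5',
            List.cons_merge_cons_neg _ _ _ (by simp [keyLe, h']), ← seg_of_lt h4']
          simp
        · refine (hI'.move (i := 4) (j := 5) (ei := 6) (ej := 7) (by simp) (by omega) ?_).mono le_rfl (by rwa [hυ8, hυ12] at fin ⊢)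
          have h' : ¬ υ.realReg 3 < υ.realReg 2 := h
          rw [hυ2, hυ3, not_lt] at h'
          rw [hυ4, hυ5, hυ6, hυ7, hυV, hυR, seg_of_lt h4', seg_of_lt h5',
            List.cons_merge_cons_pos _ _ _ (by simp [keyLe, h']), ← seg_of_lt h5']
          simp
      · have h4' : τ.natReg 4 < τ.natReg 6 := h4
        have h5' : ¬ τ.natReg 5 < τ.natReg 7 := h5
        have h57 : τ.natReg 5 = τ.natReg 7 := le_antisymm hI.le5 (not_lt.1 h5')
        refine (hI.move (i := 4) (j := 5) (ei := 6) (ej := 7) (by simp) (by omega) ?_).mono (by omega) fin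
        rw [h57, seg_self, seg_of_lt h4']
        simp [seg_self]
    · have h4' : ¬ τ.natReg 4 < τ.natReg 6 := h4
      have h46 : τ.natReg 4 = τ.natReg 6 := le_antisymm hI.le4 (not_lt.1 h4')
      have h5' : τ.natReg 5 < τ.natReg 7 := by have := hI.le5; omega
      refine (hI.move (i := 5) (j := 4) (ei := 7) (ej := 6) (by simp) (by omega) ?_).mono (by omega) fin
      rw [h46, seg_self, seg_of_lt h5']
      simp [seg_self]
  · rintro τ ⟨hI, hb⟩
    have hb' : ¬ τ.natReg 8 < τ.natReg 12 := hb
    have hcount := hI.count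
    have := hI.le4
    have := hI.le5
    have h12' := hI.reg 12 (by simp) (by simp) (by simp) (by simp) (by simp)
    have hm := hI.merged
    rw [show τ.natReg 4 = τ.natReg 6 by omega, show τ.natReg 5 = τ.natReg 7 by omega,
      seg_self, seg_self, List.nil_merge, List.append_nil] at hm
    exact ⟨hI, hm, by omega⟩

/-- The queue of sorted runs `[S k, S (k + 1))`, `rd ≤ k < r`, which fills `[i, o)`. -/
structure RunQueue (n : ℕ) (f : ℕ → ℝ) (V S : ℕ → ℕ) (r rd i o : ℕ) : Prop where
  count : 2 * r = 2 * n + rd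
  nonempty : rd < r ∨ n = 0
  first : S rd = i
  last : S r = o
  mono : ∀ k, rd ≤ k → k < r → S k ≤ S (k + 1)
  sorted : ∀ k, rd ≤ k → k < r → KeySorted f (seg V (S k) (S (k + 1)))
  perm : (seg V i o).Perm (List.range n)

/-- The total number of moves of elements in the merges still to come. -/
def movesLeft (n : ℕ) (S : ℕ → ℕ) (r rd : ℕ) : ℕ :=
  ∑ k ∈ Finset.Ico rd r, (S (k + 1) - S k) * Nat.log 2 (2 * n - 1 - k)

theorem RunQueue.le_last {n : ℕ} {f : ℕ → ℝ} {V S : ℕ → ℕ} {r rd i o k : ℕ}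
    (h : RunQueue n f V S r rd i o) (h₁ : rd ≤ k) (h₂ : k ≤ r) : S k ≤ o := by
  suffices ∀ l, k ≤ l → l ≤ r → S k ≤ S l from h.last ▸ this r h₂ le_rfl
  intro l hl
  induction l, hl using Nat.le_induction with
  | base => exact fun _ => le_rfl
  | succ l hl ih => exact fun hlr => (ih (by omega)).trans (h.mono l (h₁.trans hl) hlr)

/-- Number run `k` by `2 * n - 1 - k`. This is heap numbering of the merge tree: the final run gets
1, and the runs numbered `2 * x + 1` and `2 * x` merge into the run numbered `x`. The binary
logarithm of this number is thus the number of merges an element of the run still goes through, and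
each merge lowers `movesLeft` by exactly the number of elements moved. -/
theorem RunQueue.step {n : ℕ} {f : ℕ → ℝ} {V S W : ℕ → ℕ} {r rd i o o' : ℕ}
    (h : RunQueue n f V S r rd i o) (hlt : rd + 1 < r) (hW : ∀ k < o, W k = V k)
    (ho' : o' = o + (S (rd + 2) - i))
    (hm : seg W o o' =
      List.merge (seg V i (S (rd + 1))) (seg V (S (rd + 1)) (S (rd + 2))) (keyLe f)) :
    RunQueue n f W (Function.update S (r + 1) o') (r + 1) (rd + 2) (S (rd + 2)) o' ∧
      movesLeft n (Function.update S (r + 1) o') (r + 1) (rd + 2) + (S (rd + 2) - i) =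
        movesLeft n S r rd := by
  have hS : ∀ k ≤ r, Function.update S (r + 1) o' k = S k := fun k hk =>
    Function.update_of_ne (by omega) _ _
  have hc := h.count
  have hle : ∀ k, rd ≤ k → k ≤ r → S k ≤ o := fun k => h.le_last
  have hf := h.first
  have hl := h.last
  have m1 := h.mono rd le_rfl (by omega)
  have m2 : S (rd + 1) ≤ S (rd + 2) := h.mono (rd + 1) (by omega) (by omega)
  have h2 := hle (rd + 2) (by omega) (by omega)
  constructor
  · refine ⟨by omega, by omega, hS _ (by omega), Function.update_self _ _ _, ?_, ?_, ?_⟩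
    · intro k hk hkr
      rw [hS k (by omega)]
      rcases Nat.lt_succ_iff_lt_or_eq.1 hkr with hk' | rfl
      · rw [hS _ (by omega)]
        exact h.mono k (by omega) hk'
      · rw [Function.update_self]
        omega
    · intro k hk hkr
      rw [hS k (by omega)]
      rcases Nat.lt_succ_iff_lt_or_eq.1 hkr with hk' | rfl
      · rw [hS _ (by omega), seg_congr (W := V)]
        · exact h.sorted k (by omega) hk'
        · intro l _ hl'
          exact hW l (hl'.trans_le (hle _ (by omega) (by omega)))
      · rw [Function.update_self, hl, hm]
        refine KeySorted.merge ?_ (h.sorted (rd + 1) (by omega) (by omega))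
        rw [← hf]
        exact h.sorted rd le_rfl (by omega)
    · rw [← seg_append h2 (by omega), hm, seg_congr (W := V) fun k _ hk => hW k hk]
      refine ((List.merge_perm_append _).append_left _).trans ?_
      rw [seg_append (by omega) m2]
      refine List.perm_append_comm.trans ?_
      rw [seg_append (by omega) h2]
      exact h.perm
  -- `count` forces `rd` to be even, so the first run in the queue has an odd heap number.
  · obtain ⟨x, hx⟩ : ∃ x, 2 * n - 1 - rd = 2 * x + 1 := ⟨(2 * n - 1 - rd) / 2, by omega⟩
    have e1 : Nat.log 2 (2 * n - 1 - rd) = Nat.log 2 x + 1 := by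
      rw [hx, Nat.log_of_one_lt_of_le (by simp) (by omega)]
      congr 2; omega
    have e2 : Nat.log 2 (2 * n - 1 - (rd + 1)) = Nat.log 2 x + 1 := by
      rw [show 2 * n - 1 - (rd + 1) = 2 * x by omega,
        Nat.log_of_one_lt_of_le (by simp) (by omega)]
      congr 2; omega
    simp only [movesLeft]
    rw [Finset.sum_Ico_succ_top (by omega), Finset.sum_eq_sum_Ico_succ_bot (by omega : rd < r),
      Finset.sum_eq_sum_Ico_succ_bot hlt, e1, e2, hS r le_rfl, Function.update_self, hl,
      show 2 * n - 1 - r = x by omega, hf]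
    rw [hf] at m1
    rw [Finset.sum_congr rfl (g := fun k => (S (k + 1) - S k) * Nat.log 2 (2 * n - 1 - k))]
    · obtain ⟨a, ha⟩ := Nat.exists_eq_add_of_le m1
      obtain ⟨b, hb⟩ := Nat.exists_eq_add_of_le m2
      rw [show o' - o = a + b by omega, show S (rd + 1 + 1) - S (rd + 1) = b by rw [hb]; omega,
        show S (rd + 1) - i = a by omega, show S (rd + 2) - i = a + b by
          omega]
      ring
    · intro k hk
      rw [Finset.mem_Ico] at hk
      rw [hS _ (by omega), hS _ (by omega)]

/-- Merges runs until only one is left. -/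
def mergeRuns : Program :=
  .while (.natLt 9 2)
    (.seq (block [.natRead 6 3 9, .natAdd 9 9 1, .natRead 7 3 9, .natAdd 9 9 1, .natAdd 5 6 11,
        .natSub 12 7 4, .natAdd 12 8 12])
      (.seq mergeLoop (block [.natAdd 2 2 1, .natWrite 3 2 8, .natAdd 4 7 11])))

/-- Sorts the jobs: their indices, by increasing processing times, are written to `[reg 4, reg 8)`
in natural array `2`. Real register `1` gets the number of jobs times the setup time. -/
def sortJobs : Program :=
  .seq (block [.natConst 1 1, .natConst 9 1])
    (.seq (.while (.natLt 2 0)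
        (block [.natAdd 2 2 1, .natWrite 3 2 2, .natWrite 2 2 2, .realAdd 1 1 0]))
      (.seq (block [.natAdd 8 2 11]) mergeRuns))

/-- What is common to the states during sorting. -/
structure SortFrame (n : ℕ) (s : ℝ) (arr : ℕ → ℕ → ℝ) (σ : State) : Prop where
  reg0 : σ.natReg 0 = n
  reg1 : σ.natReg 1 = 1
  reg11 : σ.natReg 11 = 0
  regHigh : ∀ r, 15 ≤ r → σ.natReg r = 0
  real0 : σ.realReg 0 = s
  realHigh : ∀ r, 4 ≤ r → σ.realReg r = 0
  realArr : σ.realArr = arr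

/-- Register `9` is one ahead of the first run's index: the start of that run is already in register
`4`, and its end is the next boundary to be read. -/
structure MergeRunsInv (n : ℕ) (s : ℝ) (arr : ℕ → ℕ → ℝ) (σ : State) : Prop
    extends SortFrame n s arr σ where
  real1 : σ.realReg 1 = n * s
  reg9 : 1 ≤ σ.natReg 9
  queue : RunQueue n (arr 0) (σ.natArr 2) (σ.natArr 3) (σ.natReg 2) (σ.natReg 9 - 1) (σ.natReg 4)
    (σ.natReg 8)

structure JobsSorted (n : ℕ) (s : ℝ) (arr : ℕ → ℕ → ℝ) (σ : State) : Prop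
    extends SortFrame n s arr σ where
  real1 : σ.realReg 1 = n * s
  perm : (seg (σ.natArr 2) (σ.natReg 4) (σ.natReg 8)).Perm (List.range n)
  sorted : KeySorted (arr 0) (seg (σ.natArr 2) (σ.natReg 4) (σ.natReg 8))

/-- The potential pays 14 for every remaining move, and 14 for every run in the queue, whose number
drops by one per merge. -/
theorem mergeRuns_spec {n : ℕ} {s : ℝ} {arr : ℕ → ℕ → ℝ} {σ : State} {T : ℕ}
    (h : MergeRunsInv n s arr σ)
    (hT : 14 * movesLeft n (σ.natArr 3) (σ.natReg 2) (σ.natReg 9 - 1) +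
      14 * (σ.natReg 2 - (σ.natReg 9 - 1)) + 1 ≤ T) :
    Runs mergeRuns σ T (JobsSorted n s arr) := by
  refine (Runs.loop (MergeRunsInv n s arr) (fun τ =>
    14 * movesLeft n (τ.natArr 3) (τ.natReg 2) (τ.natReg 9 - 1) +
      14 * (τ.natReg 2 - (τ.natReg 9 - 1))) h hT ?_).mono le_rfl ?_
  · intro σ h hb
    have hb' : σ.natReg 9 < σ.natReg 2 := hb
    obtain ⟨⟨a0, a1, a11, ah, b0, bh, ba⟩, b1, a9, q⟩ := h
    obtain ⟨rd, hrd⟩ := Nat.exists_eq_add_of_le' a9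
    have hrd' : σ.natReg 9 - 1 = rd := by omega
    rw [hrd'] at q
    simp only [hrd']
    have hf := q.first
    have m1 := q.mono rd le_rfl (by omega)
    have m2 : σ.natArr 3 (rd + 1) ≤ σ.natArr 3 (rd + 2) := q.mono (rd + 1) (by omega) (by omega)
    have hle := q.le_last (k := rd + 2) (by omega) (by omega)
    refine ⟨14 * (σ.natArr 3 (rd + 2) - σ.natReg 4) + 13, ?_⟩
    refine Runs.block_seq (T := 14 * (σ.natArr 3 (rd + 2) - σ.natReg 4) + 5)
      (by simp; omega) ?_
    set υ := applyAll [.natRead 6 3 9, .natAdd 9 9 1, .natRead 7 3 9, .natAdd 9 9 1,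
      .natAdd 5 6 11, .natSub 12 7 4, .natAdd 12 8 12] σ with hυ
    have u4 : υ.natReg 4 = σ.natReg 4 := by simp [hυ, applyAll, Instr.apply]
    have u5 : υ.natReg 5 = σ.natArr 3 (rd + 1) := by
      simp [hυ, applyAll, Instr.apply, a11, hrd]
    have u6 : υ.natReg 6 = σ.natArr 3 (rd + 1) := by simp [hυ, applyAll, Instr.apply, hrd]
    have u7 : υ.natReg 7 = σ.natArr 3 (rd + 2) := by simp [hυ, applyAll, Instr.apply, hrd, a1]
    have u8 : υ.natReg 8 = σ.natReg 8 := by simp [hυ, applyAll, Instr.apply]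
    have u9 : υ.natReg 9 = rd + 3 := by simp [hυ, applyAll, Instr.apply, hrd, a1]
    have u12 : υ.natReg 12 = σ.natReg 8 + (σ.natArr 3 (rd + 2) - σ.natReg 4) := by
      simp [hυ, applyAll, Instr.apply, hrd, a1]
    have ur : ∀ r, r ≠ 5 → r ≠ 6 → r ≠ 7 → r ≠ 9 → r ≠ 12 → υ.natReg r = σ.natReg r := by
      intro r h5 h6 h7 h9 h12
      simp [hυ, applyAll, Instr.apply, h5, h6, h7, h9, h12]
    have uV : υ.natArr = σ.natArr := by simp [hυ, applyAll, Instr.apply]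
    have uR : υ.realReg = σ.realReg := by simp [hυ, applyAll, Instr.apply]
    have uA : υ.realArr = σ.realArr := by simp [hυ, applyAll, Instr.apply]
    have hm := mergeLoop_spec (σ := υ) (T := 14 * (σ.natArr 3 (rd + 2) - σ.natReg 4) + 1)
      (by omega) (by omega) (by omega) (by omega) (by omega)
      (by rw [ur 1 (by simp) (by simp) (by simp) (by simp) (by simp), a1]) (by omega)
    refine (Runs.seq (U := 4) (hm.mono le_rfl ?_)).mono (by omega) fun _ => id
    rintro τ ⟨hI, hseg, h8⟩
    rw [u8, uV, u4, u6, u7, uA, ba] at hseg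
    rw [u8, u7, u4] at h8
    have tr : ∀ r, r ≠ 4 → r ≠ 5 → r ≠ 6 → r ≠ 7 → r ≠ 8 → r ≠ 9 → r ≠ 12 → r ≠ 13 → r ≠ 14 →
        τ.natReg r = σ.natReg r := fun r h4 h5 h6 h7 h8 h9 h12 h13 h14 =>
      (hI.reg r h4 h5 h8 h13 h14).trans (ur r h5 h6 h7 h9 h12)
    have t2 : τ.natReg 2 = σ.natReg 2 := by apply tr <;> simp
    have t1 : τ.natReg 1 = 1 := hI.one
    have t0 : τ.natReg 0 = n := by rw [← a0]; apply tr <;> simp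
    have t11 : τ.natReg 11 = 0 := by rw [← a11]; apply tr <;> simp
    have t9 : τ.natReg 9 = rd + 3 := by rw [← u9]; apply hI.reg <;> simp
    have t7 : τ.natReg 7 = σ.natArr 3 (rd + 2) := by rw [← u7]; apply hI.reg <;> simp
    have tS : τ.natArr 3 = σ.natArr 3 := by rw [hI.arr 3 (by simp), uV]
    have hq := q.step (W := τ.natArr 2) (by omega)
      (fun k hk => by rw [hI.old k (by rwa [u8]), uV]) h8 hseg
    refine Runs.of_block ?_ (by simp)
    simp only [applyAll, Instr.apply]
    constructor
    · refine ⟨⟨?_, ?_, ?_, ?_, ?_, ?_, ?_⟩, ?_, ?_, ?_⟩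
      · simp [t0]
      · simp [t1]
      · simp [t11]
      · intro r hr
        simp only [Function.update_apply, if_neg (show r ≠ 4 by omega),
          if_neg (show r ≠ 2 by omega)]
        rw [← ah r hr]
        apply tr <;> omega
      · rw [← b0, hI.real0, uR]
      · intro r hr
        rw [← bh r hr, hI.realHigh r hr, uR]
      · rw [← ba, hI.realArr, uA]
      · rw [← b1, hI.real1, uR]
      · simp [t9]
      · simp [t9, t1, t2, t7, t11, tS]
        exact hq.1
    · simp [t9, t1, t2, tS]
      have := hq.2
      omega
  · rintro τ ⟨⟨hF, b1, a9, q⟩, hb⟩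
    have hb' : ¬ τ.natReg 9 < τ.natReg 2 := hb
    refine ⟨hF, b1, q.perm, ?_⟩
    have hc := q.count
    -- Without jobs there is no run at all, and the empty segment is trivially sorted.
    rcases q.nonempty with hlt | rfl
    · have := q.sorted _ le_rfl hlt
      rwa [q.first, show τ.natReg 9 - 1 + 1 = τ.natReg 2 by omega, q.last] at this
    · have := q.perm
      rw [List.range_zero, List.perm_nil] at this
      rw [this]
      exact List.Pairwise.nil

/-! ### Singleton runs and the cost of sorting. -/

structure InitRunsInv (n : ℕ) (s : ℝ) (arr : ℕ → ℕ → ℝ) (σ : State) : Prop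
    extends SortFrame n s arr σ where
  le : σ.natReg 2 ≤ n
  real1 : σ.realReg 1 = σ.natReg 2 * s
  reg4 : σ.natReg 4 = 0
  reg9 : σ.natReg 9 = 1
  runs : ∀ k ≤ σ.natReg 2, σ.natArr 3 k = k
  entries : ∀ k ≤ σ.natReg 2, σ.natArr 2 k = k

theorem RunQueue.init {n : ℕ} {f : ℕ → ℝ} {V S : ℕ → ℕ} (hV : ∀ k ≤ n, V k = k)
    (hS : ∀ k ≤ n, S k = k) : RunQueue n f V S n 0 0 n := by
  refine ⟨by omega, by omega, hS 0 (by omega), hS n le_rfl, ?_, ?_, ?_⟩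
  · intro k _ hk
    rw [hS k hk.le, hS (k + 1) hk]
    omega
  · intro k _ hk
    rw [hS k hk.le, hS (k + 1) hk, seg_of_lt (by omega), seg_self]
    exact List.pairwise_singleton _ _
  · rw [seg_congr (W := id) fun k _ hk => hV k hk.le, seg, List.map_id, Nat.sub_zero,
      List.range_eq_range']

/-- Each of the `n` singleton runs lies at depth at most `log₂ (2 * n)` in the merge tree. -/
theorem movesLeft_init_le {n : ℕ} {S : ℕ → ℕ} (hS : ∀ k ≤ n, S k = k) :
    movesLeft n S n 0 ≤ n * Nat.log 2 (2 * n) := by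
  refine (Finset.sum_le_card_nsmul _ _ (Nat.log 2 (2 * n)) ?_).trans_eq (by simp)
  intro k hk
  rw [Finset.mem_Ico] at hk
  rw [hS k hk.2.le, hS (k + 1) hk.2, Nat.add_sub_cancel_left, one_mul]
  exact Nat.log_mono_right (by omega)

theorem sortJobs_spec {n : ℕ} (p : Fin n → ℝ) (s : ℝ) {T : ℕ}
    (hT : 14 * (n * Nat.log 2 (2 * n)) + 20 * n + 7 ≤ T) :
    Runs sortJobs (inputState p s) T (JobsSorted n s (inputState p s).realArr) := by
  refine Runs.block_seq (T := 14 * (n * Nat.log 2 (2 * n)) + 20 * n + 4) (by simp; omega) ?_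
  refine (Runs.seq (T := 6 * n + 1) (U := 14 * (n * Nat.log 2 (2 * n)) + 14 * n + 3)
    ((Runs.loop (InitRunsInv n s (inputState p s).realArr) (fun τ => 6 * (n - τ.natReg 2))
      ?_ ?_ ?_).mono le_rfl ?_)).mono (by omega) fun _ => id
  · simp only [applyAll, Instr.apply, inputState]
    refine ⟨⟨?_, ?_, ?_, ?_, ?_, ?_, ?_⟩, ?_, ?_, ?_, ?_, ?_, ?_⟩ <;>
      simp +contextual [Function.update_apply]
    · intro r hr
      simp [show r ≠ 0 by omega, show r ≠ 1 by omega, show r ≠ 9 by omega]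
    · omega
  · simp [applyAll, Instr.apply, inputState]
  · intro σ h hb
    have hb' : σ.natReg 2 < σ.natReg 0 := hb
    obtain ⟨⟨a0, a1, a11, ah, b0, bh, ba⟩, h2, b1, a4, a9, hS, hV⟩ := h
    refine ⟨5, Runs.of_block ?_ (by simp)⟩
    simp only [applyAll, Instr.apply]
    refine ⟨⟨⟨?_, ?_, ?_, ?_, ?_, ?_, ?_⟩, ?_, ?_, ?_, ?_, ?_, ?_⟩, ?_⟩
    · simp [a0]
    · simp [a1]
    · simp [a11]
    · intro r hr
      simp [show r ≠ 2 by omega, ah r hr]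
    · simp [b0]
    · intro r hr
      simp [show r ≠ 1 by omega, bh r hr]
    · exact ba
    · simp [a1]; omega
    · simp [a1, b1, b0]; ring
    · simp [a4]
    · simp [a9]
    · intro k hk
      simp [a1] at hk ⊢
      rcases Nat.le_succ_iff.1 hk with hk | rfl
      · simp [show k ≠ σ.natReg 2 + 1 by omega, hS k hk]
      · simp
    · intro k hk
      simp [a1] at hk ⊢
      rcases Nat.le_succ_iff.1 hk with hk | rfl
      · simp [show k ≠ σ.natReg 2 + 1 by omega, hV k hk]
      · simp
    · simp [a1]; omega
  · rintro σ ⟨⟨⟨a0, a1, a11, ah, b0, bh, ba⟩, h2, b1, a4, a9, hS, hV⟩, hb⟩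
    have hb' : ¬ σ.natReg 2 < σ.natReg 0 := hb
    have h2 : σ.natReg 2 = n := by omega
    rw [h2] at b1 hS hV
    refine Runs.block_seq (T := 14 * (n * Nat.log 2 (2 * n)) + 14 * n + 1) (by simp; omega) ?_
    simp only [applyAll, Instr.apply]
    refine mergeRuns_spec ⟨⟨?_, ?_, ?_, ?_, ?_, ?_, ?_⟩, ?_, ?_, ?_⟩ ?_
    · simp [a0]
    · simp [a1]
    · simp [a11]
    · intro r hr
      simp [show r ≠ 8 by omega, ah r hr]
    · simp [b0]
    · exact bh
    · exact ba
    · exact b1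
    · simp [a9]
    · simpa [a9, h2, a4, a11] using RunQueue.init hV hS
    · simpa [a9, h2] using movesLeft_init_le hS

open Finset

/-! ### Lower bound -/

/-- `q (k - 2) + q (k - 4) + ⋯`. -/
def altSum (q : ℕ → ℝ) : ℕ → ℝ
  | 0 => 0
  | 1 => 0
  | k + 2 => altSum q k + q k

theorem sum_range_sum_range_succ (f : ℕ → ℝ) (n : ℕ) :
    ∑ k ∈ range n, ∑ l ∈ range (k + 1), f l = ∑ l ∈ range n, ((n : ℝ) - l) * f l := by
  induction n with
  | zero => simp
  | succ n ih =>
    rw [sum_range_succ, ih, sum_range_succ (fun l => (((n + 1 : ℕ) : ℝ) - l) * f l), sum_range_succ f,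
      ← add_assoc, ← sum_add_distrib]
    congr 1
    · exact sum_congr rfl fun l _ => by push_cast; ring
    · push_cast; ring

/-- Double counting: the extra setup of job `k ≥ K` delays the `n - k` jobs from position `k` on. -/
theorem sum_range_sub_eq (s : ℝ) {K n : ℕ} (h : K ≤ n) :
    ∑ l ∈ range n, s * ((l + 1 - K : ℕ) : ℝ) = ∑ l ∈ Ico K n, s * ((n : ℝ) - l) := by
  induction n, h using Nat.le_induction with
  | base =>
    rw [Ico_self, sum_empty]
    refine sum_eq_zero fun l hl => ?_
    rw [mem_range] at hl
    rw [show l + 1 - K = 0 by omega, Nat.cast_zero, mul_zero]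
  | succ n hn ih =>
    rw [sum_range_succ, ih, sum_Ico_succ_top hn,
      sum_congr (s₁ := Ico K n) rfl fun (l : ℕ) _ =>
        show s * (((n + 1 : ℕ) : ℝ) - l) = s * ((n : ℝ) - l) + s by
        push_cast; ring,
      sum_add_distrib, sum_const, Nat.card_Ico, nsmul_eq_mul, Nat.cast_sub (by omega),
      Nat.cast_sub hn]
    push_cast
    ring

/-- Bounds the sum of the differences `D` from below by weights `e` of the jobs and a constant `C`,
for which splitting exactly the jobs from some position on is best for sorted jobs. -/
theorem exists_weights {n : ℕ} {s : ℝ} (hs : 0 < s) {r D : ℕ → ℝ} (split : ℕ → Prop)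
    [DecidablePred split] (hD : ∀ k ≤ n, 0 ≤ D k)
    (hr : ∀ k < n, ¬ split k → r k ≤ D k + D (k + 1)) (hD0 : D 0 = 0) (j : ℕ) (hj : j ≤ n) :
    ∃ (e : ℕ → ℝ) (C : ℝ), (∀ k, e k = 0 ∨ e k = 1) ∧
      C + ∑ k ∈ range j, e k * r k ≤
        ∑ k ∈ range j, (if split k then s * ((n : ℝ) - k) else 0) + ∑ k ∈ range j, D (k + 1) ∧
      ∀ q : ℕ → ℝ, (∀ k l, k ≤ l → l < n → q k ≤ q l) →
        ∃ K ≤ j, altSum q (K + 1) + ∑ k ∈ Ico K j, s * ((n : ℝ) - k) ≤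
          C + ∑ k ∈ range j, e k * q k := by
  induction j using Nat.strong_induction_on with
  | _ j ih =>
    match j with
    | 0 => exact ⟨0, 0, by simp, by simp, fun q _ => ⟨0, le_rfl, by simp [altSum]⟩⟩
    | j + 1 =>
      by_cases hsp : split j
      · obtain ⟨e, C, he, hle, hq⟩ := ih j (by omega) (by omega)
        have hsum : ∀ f : ℕ → ℝ, ∑ k ∈ range (j + 1), Function.update e j 0 k * f k =
            ∑ k ∈ range j, e k * f k := by
          intro f
          rw [sum_range_succ, Function.update_self, zero_mul, add_zero]
          refine sum_congr rfl fun k hk => ?_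
          rw [mem_range] at hk
          rw [Function.update_of_ne (by omega)]
        -- A split last job moves its setup penalty into the constant. Its own difference `D (j +
        -- 1)` is only bounded by zero, and `K` stays the same.
        refine ⟨Function.update e j 0, C + s * ((n : ℝ) - j), ?_, ?_, ?_⟩
        · intro k
          rcases eq_or_ne k j with rfl | hk
          · simp
          · rw [Function.update_of_ne hk]
            exact he k
        · rw [hsum, sum_range_succ, sum_range_succ _ j, if_pos hsp]
          have := hD (j + 1) hj
          linarith
        · intro q hmono
          obtain ⟨K, hK, h⟩ := hq q hmono
          refine ⟨K, by omega, ?_⟩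
          rw [hsum, sum_Ico_succ_top hK]
          linarith
      · match j with
        | 0 =>
          -- A single unsplit job has no predecessor to pair with; `D 0 = 0` takes that place.
          refine ⟨fun _ => 1, 0, by simp, ?_, fun q _ => ⟨1, le_rfl, by simp [altSum]⟩⟩
          have := hr 0 hj hsp
          simp [hsp]
          simpa [hD0] using this
        | i + 1 =>
          obtain ⟨e, C, he, hle, hq⟩ := ih i (by omega) (by omega)
          -- An unsplit last job uses up `D (i + 1) + D (i + 2)`, so two positions are removed. Job
          -- `i + 1` gets weight 1, job `i` gets weight 0, and a possible penalty of job `i` is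
          -- dropped.
          set e' := Function.update (Function.update e i 0) (i + 1) 1 with he'
          have hsum : ∀ f : ℕ → ℝ, ∑ k ∈ range (i + 1 + 1), e' k * f k =
              ∑ k ∈ range i, e k * f k + f (i + 1) := by
            intro f
            rw [sum_range_succ, sum_range_succ]
            simp only [he', Function.update_self]
            rw [Function.update_of_ne (by omega), Function.update_self, zero_mul, add_zero, one_mul]
            congr 1
            refine sum_congr rfl fun k hk => ?_
            rw [mem_range] at hk
            rw [Function.update_of_ne (by omega), Function.update_of_ne (by omega)]
          refine ⟨e', C, ?_, ?_, ?_⟩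
          · intro k
            rcases eq_or_ne k (i + 1) with rfl | hk
            · simp [he']
            · rw [he', Function.update_of_ne hk]
              rcases eq_or_ne k i with rfl | hk
              · simp
              · rw [Function.update_of_ne hk]
                exact he k
          · rw [hsum, sum_range_succ, sum_range_succ, sum_range_succ _ (i + 1),
              sum_range_succ _ i, if_neg hsp]
            have := hr (i + 1) hj hsp
            have : (0 : ℝ) ≤ if split i then s * ((n : ℝ) - i) else 0 := by
              have : (i : ℝ) + 1 + 1 ≤ n := by exact_mod_cast hj
              split_ifs
              · exact mul_nonneg hs.le (by linarith)
              · exact le_rfl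
            linarith
          · intro q hmono
            obtain ⟨K, hK, h⟩ := hq q hmono
            -- Raising the threshold by 2 adds `q (K + 1)`, which is at most `q (i + 1)` by
            -- sortedness, and shifts the penalties two positions later, where they are smaller.
            refine ⟨K + 2, by omega, ?_⟩
            rw [hsum]
            have h1 : q (K + 1) ≤ q (i + 1) := hmono _ _ (by omega) (by omega)
            have h2 : ∑ k ∈ Ico (K + 2) (i + 2), s * ((n : ℝ) - k) ≤
                ∑ k ∈ Ico K i, s * ((n : ℝ) - k) := by
              rw [← sum_Ico_add']
              refine sum_le_sum fun k _ => mul_le_mul_of_nonneg_left ?_ hs.le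
              push_cast
              linarith
            have h3 : altSum q (K + 2 + 1) = altSum q (K + 1) + q (K + 1) := rfl
            rw [h3]
            linarith

/-- Sorting the jobs minimises sums with such weights. -/
theorem sum_weights_le {n : ℕ} {e q r : ℕ → ℝ} (he : ∀ k, e k = 0 ∨ e k = 1)
    (hq : ∀ k l, k ≤ l → l < n → q k ≤ q l) (ρ : Equiv.Perm (Fin n))
    (hr : ∀ k : Fin n, r k = q (ρ k)) :
    ∑ k ∈ range n, ((n : ℝ) - k) * q k + ∑ k ∈ range n, e k * q k ≤
      ∑ k ∈ range n, ((n : ℝ) - k) * r k + ∑ k ∈ range n, e k * r k := by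
  simp only [← sum_add_distrib, ← add_mul]
  rw [← Fin.sum_univ_eq_sum_range (fun k => ((n : ℝ) - k + e k) * q k),
    ← Fin.sum_univ_eq_sum_range (fun k => ((n : ℝ) - k + e k) * r k)]
  -- The factor `n - k` drops by at least 1 between different positions, and weights in `{0, 1}` can
  -- rise by at most 1.
  have hanti : Antitone fun k : Fin n => (n : ℝ) - (k : ℕ) + e k := by
    intro k l hkl
    rcases hkl.eq_or_lt with rfl | hlt
    · exact le_rfl
    · have : ((k : ℕ) : ℝ) + 1 ≤ ((l : ℕ) : ℝ) := by exact_mod_cast hlt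
      have h1 : 0 ≤ e k := by rcases he k with h | h <;> simp [h]
      have h2 : e l ≤ 1 := by rcases he l with h | h <;> simp [h]
      show (n : ℝ) - (l : ℕ) + e l ≤ (n : ℝ) - (k : ℕ) + e k
      linarith
  have hmono : Monotone fun k : Fin n => q k := fun k l hkl => hq k l hkl l.2
  simp only [hr]
  exact (hanti.antivary hmono).sum_mul_le_sum_mul_comp_perm

/-! ### Machine loads in an arbitrary feasible schedule. -/

theorem Schedule.finish_le_completionTime {m : ℕ} (S : Schedule n m)
    (s : ℝ) (a : Fin S.numParts) :
    (S.part a).finish s ≤ S.completionTime s (S.part a).job :=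
  le_ciSup (f := fun b : {b : Fin S.numParts // (S.part b).job = (S.part a).job} =>
    (S.part b).finish s) (Set.finite_range _).bddAbove ⟨a, rfl⟩

namespace Schedule.IsFeasible

variable {n : ℕ} {S : Schedule n 2} {p : Fin n → ℝ} {s : ℝ}

theorem completionTime_nonneg (h : S.IsFeasible p s) (hs : 0 < s) (j : Fin n) :
    0 ≤ S.completionTime s j :=
  Real.iSup_nonneg fun a => by
    have := h.start_nonneg a
    have := h.length_pos a
    unfold Part.finish
    linarith

/-- The time a machine needs for a set of parts that are finished by time `t` is at most `t`. -/
theorem sum_le_of_finish_le (h : S.IsFeasible p s) (hs : 0 < s) (X : Finset (Fin S.numParts))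
    (hX : ∀ a ∈ X, ∀ b ∈ X, (S.part a).machine = (S.part b).machine) (t : ℝ) (ht : 0 ≤ t)
    (hfin : ∀ a ∈ X, (S.part a).finish s ≤ t) : ∑ a ∈ X, (s + (S.part a).length) ≤ t := by
  induction hc : X.card generalizing X t with
  | zero => rwa [card_eq_zero.1 hc, sum_empty]
  | succ k ih =>
    -- All other parts are finished when the part with the latest start begins.
    obtain ⟨a, ha, hmax⟩ := X.exists_max_image (fun a => (S.part a).start)
      (card_pos.1 (by omega))
    have hrest := ih (X.erase a)
      (fun b hb c hc => hX b (mem_of_mem_erase hb) c (mem_of_mem_erase hc)) (S.part a).start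
      (h.start_nonneg a) (fun b hb => ?_) (by rw [card_erase_of_mem ha, hc]; rfl)
    · rw [← add_sum_erase X _ ha]
      have := hfin a ha
      unfold Part.finish at this
      linarith
    · have hb' := mem_of_mem_erase hb
      rcases h.no_overlap b a (ne_of_mem_erase hb) (hX b hb' a ha) with h1 | h1
      · exact h1
      · have := hmax b hb'
        have := h.length_pos a
        unfold Part.finish at h1
        linarith

/-- All parts with machine `μ` finish by `t`, the others by `u`. -/
theorem sum_le_add (h : S.IsFeasible p s) (hs : 0 < s) (X : Finset (Fin S.numParts)) (μ : Fin 2)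
    {t u : ℝ} (ht : 0 ≤ t) (hu : 0 ≤ u)
    (hfin : ∀ a ∈ X, (S.part a).machine = μ → (S.part a).finish s ≤ t)
    (hfin' : ∀ a ∈ X, (S.part a).machine ≠ μ → (S.part a).finish s ≤ u) :
    ∑ a ∈ X, (s + (S.part a).length) ≤ t + u := by
  rw [← sum_filter_add_sum_filter_not X fun a => (S.part a).machine = μ]
  refine add_le_add (h.sum_le_of_finish_le hs _ ?_ t ht ?_) (h.sum_le_of_finish_le hs _ ?_ u hu ?_)
  · intro a ha b hb
    rw [(mem_filter.1 ha).2, (mem_filter.1 hb).2]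
  · exact fun a ha => hfin a (mem_filter.1 ha).1 (mem_filter.1 ha).2
  · intro a ha b hb
    have h1 := (mem_filter.1 ha).2
    have h2 := (mem_filter.1 hb).2
    omega
  · exact fun a ha => hfin' a (mem_filter.1 ha).1 (mem_filter.1 ha).2

theorem sum_parts_of_job (h : S.IsFeasible p s) (j : Fin n) :
    ∑ a with (S.part a).job = j, (s + (S.part a).length) =
      #{a | (S.part a).job = j} * s + p j := by
  rw [sum_add_distrib, h.complete, sum_const, nsmul_eq_mul]

theorem parts_nonempty (h : S.IsFeasible p s) (hp : ∀ j, 0 < p j) (j : Fin n) :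
    0 < #{a | (S.part a).job = j} := by
  rw [card_pos, nonempty_iff_ne_empty]
  intro h0
  have := h.complete j
  rw [h0, sum_empty] at this
  exact (hp j).ne this

/-- The lower bound on the total completion time: `τ` sorts the jobs, `q` lists their processing
times plus the setup time in that order. -/
theorem exists_le_two_mul_totalCompletionTime (h : S.IsFeasible p s) (hs : 0 < s)
    (hp : ∀ j, 0 < p j) (τ : Equiv.Perm (Fin n)) (q : ℕ → ℝ) (hq : ∀ k : Fin n, q k = s + p (τ k))
    (hmono : ∀ k l, k ≤ l → l < n → q k ≤ q l) :
    ∃ K ≤ n, ∑ k ∈ range n, ((n : ℝ) - k) * q k +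
      (altSum q (K + 1) + ∑ k ∈ Ico K n, s * ((n : ℝ) - k)) ≤ 2 * S.totalCompletionTime s := by
  classical
  set C := S.completionTime s with hC
  set π := Tuple.sort C with hπ
  have hCmono : Monotone (C ∘ π) := Tuple.monotone_sort C
  set r : ℕ → ℝ := fun k => if hk : k < n then s + p (π ⟨k, hk⟩) else 0 with hr
  set split : ℕ → Prop := fun k =>
    ∃ hk : k < n, #{a | (S.part a).job = π ⟨k, hk⟩} ≠ 1 with hsplit
  -- The index is the number of finished jobs, so the completion time at position `k` is `c (k +
  -- 1)`, and `c 0 = 0`.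
  set c : ℕ → ℝ := fun k => match k with
    | 0 => 0
    | k + 1 => if hk : k < n then C (π ⟨k, hk⟩) else 0 with hc
  set w : ℕ → ℝ := fun k => r k + if split k then s else 0 with hw
  set J : ℕ → Finset (Fin S.numParts) := fun k =>
    {a | ((π.symm (S.part a).job : Fin n) : ℕ) < k} with hJ
  have hc_succ : ∀ k (hk : k < n), c (k + 1) = C (π ⟨k, hk⟩) := fun k hk => dif_pos hk
  have hr_lt : ∀ k (hk : k < n), r k = s + p (π ⟨k, hk⟩) := fun k hk => dif_pos hk
  have hc_nonneg : ∀ k ≤ n, 0 ≤ c k := by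
    intro k hk
    match k with
    | 0 => exact le_rfl
    | k + 1 =>
      rw [hc_succ k hk]
      exact h.completionTime_nonneg hs _
  have hfin : ∀ k ≤ n, ∀ a ∈ J k, (S.part a).finish s ≤ c k := by
    intro k hk a ha
    have ha' : ((π.symm (S.part a).job : Fin n) : ℕ) < k := (mem_filter.1 ha).2
    match k with
    | 0 => omega
    | k + 1 =>
      rw [hc_succ k hk]
      refine (S.finish_le_completionTime s a).trans ?_
      have := @hCmono (π.symm (S.part a).job) ⟨k, hk⟩ (Fin.le_def.2 (Nat.lt_succ_iff.1 ha'))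
      simpa using this
  have hJsucc : ∀ k (hk : k < n), J (k + 1) = J k ∪ ({a | (S.part a).job = π ⟨k, hk⟩} : Finset _) := by
    intro k hk
    ext a
    simp only [hJ, mem_filter, mem_univ, true_and, mem_union, Nat.lt_succ_iff_lt_or_eq]
    refine or_congr Iff.rfl ?_
    rw [← Equiv.symm_apply_eq, Fin.ext_iff]
  -- Since every job has a part, more than one setup is needed exactly when the number of parts is
  -- not 1; only one extra setup is charged.
  have hwork : ∀ k ≤ n, ∑ l ∈ range k, w l ≤ ∑ a ∈ J k, (s + (S.part a).length) := by
    intro k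
    induction k with
    | zero => intro _; simp [hJ]
    | succ k ih =>
      intro hk
      rw [sum_range_succ, hJsucc k hk, sum_union]
      · refine add_le_add (ih (by omega)) ?_
        rw [h.sum_parts_of_job]
        have h0 := h.parts_nonempty hp (π ⟨k, hk⟩)
        simp only [hw, hr_lt k hk]
        split_ifs with hsp
        · obtain ⟨_, h1⟩ := hsp
          have : (2 : ℝ) ≤ (#{a | (S.part a).job = π ⟨k, hk⟩} : ℕ) := by
            exact_mod_cast (by omega : 2 ≤ #{a | (S.part a).job = π ⟨k, hk⟩})
          nlinarith
        · have : (1 : ℝ) ≤ (#{a | (S.part a).job = π ⟨k, hk⟩} : ℕ) := by exact_mod_cast h0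
          nlinarith
      · rw [disjoint_left]
        intro a ha hb
        have ha' : ((π.symm (S.part a).job : Fin n) : ℕ) < k := (mem_filter.1 ha).2
        rw [(mem_filter.1 hb).2, Equiv.symm_apply_apply] at ha'
        exact lt_irrefl _ ha'
  set D : ℕ → ℝ := fun k => 2 * c k - ∑ l ∈ range k, w l with hD
  have hD_nonneg : ∀ k ≤ n, 0 ≤ D k := by
    intro k hk
    have := h.sum_le_add hs (J k) 0 (hc_nonneg k hk) (hc_nonneg k hk)
      (fun a ha _ => hfin k hk a ha) fun a ha _ => hfin k hk a ha
    have := hwork k hk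
    simp only [hD]
    linarith
  have hD_add : ∀ k < n, ¬ split k → r k ≤ D k + D (k + 1) := by
    intro k hk hsp
    have hone : #{a | (S.part a).job = π ⟨k, hk⟩} = 1 := by
      by_contra h1
      exact hsp ⟨hk, h1⟩
    obtain ⟨b, hb⟩ := card_eq_one.1 hone
    -- Only the machine of the single part `b` is charged until `c (k + 1)`; on the other one the
    -- first `k + 1` jobs are finished by `c k`.
    have := h.sum_le_add hs (J (k + 1)) (S.part b).machine (hc_nonneg (k + 1) hk)
      (hc_nonneg k hk.le) (fun a ha _ => hfin (k + 1) hk a ha) fun a ha hne => by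
        rw [hJsucc k hk, hb, mem_union, mem_singleton] at ha
        rcases ha with ha | rfl
        · exact hfin k hk.le a ha
        · exact absurd rfl hne
    have := hwork (k + 1) hk
    simp only [hD]
    rw [sum_range_succ] at this ⊢
    simp only [hw, if_neg hsp, add_zero] at this ⊢
    linarith
  have hD_zero : D 0 = 0 := by simp [hD, hc]
  obtain ⟨e, Ce, he, hle, hK⟩ := exists_weights hs split hD_nonneg hD_add hD_zero n le_rfl
  obtain ⟨K, hKn, hK⟩ := hK q hmono
  refine ⟨K, hKn, ?_⟩
  -- `π` orders by completion time and `τ` by processing time, so this composition carries positions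
  -- of `r` to positions of `q`.
  have hre := sum_weights_le he hmono (π.trans τ.symm) (r := r) fun k => by
    rw [hr_lt k k.2, hq]
    simp
  have htot : S.totalCompletionTime s = ∑ k ∈ range n, c (k + 1) := by
    rw [← Fin.sum_univ_eq_sum_range (fun k => c (k + 1))]
    simp only [hc_succ _ (Fin.is_lt _)]
    exact (Equiv.sum_comp π C).symm
  have h1 : 2 * S.totalCompletionTime s =
      ∑ k ∈ range n, D (k + 1) + ∑ k ∈ range n, ∑ l ∈ range (k + 1), w l := by
    rw [← sum_add_distrib, htot, mul_sum]
    exact sum_congr rfl fun k _ => by simp only [hD]; ring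
  have h2 : ∑ l ∈ range n, ((n : ℝ) - l) * w l = ∑ l ∈ range n, ((n : ℝ) - l) * r l +
      ∑ l ∈ range n, if split l then s * ((n : ℝ) - l) else 0 := by
    rw [← sum_add_distrib]
    refine sum_congr rfl fun l _ => ?_
    simp only [hw]
    split_ifs <;> ring
  rw [sum_range_sum_range_succ, h2] at h1
  linarith

end Schedule.IsFeasible

/-! ### Choosing the number of unsplit jobs -/

/-- Twice the cost of leaving exactly the first `K` jobs unsplit, up to an additive constant. -/
noncomputable def splitCost (n : ℕ) (s : ℝ) (q : ℕ → ℝ) (K : ℕ) : ℝ :=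
  altSum q (K + 1) - ∑ k ∈ range K, s * ((n : ℝ) - k)

/-- Replacing the penalties after `K` by minus those before `K` changes the cost by a constant, and
makes it computable in a forward sweep. -/
theorem splitCost_add_sum {n : ℕ} {s : ℝ} {q : ℕ → ℝ} {K : ℕ} (h : K ≤ n) :
    splitCost n s q K + ∑ k ∈ range n, s * ((n : ℝ) - k) =
      altSum q (K + 1) + ∑ k ∈ Ico K n, s * ((n : ℝ) - k) := by
  rw [splitCost, ← sum_range_add_sum_Ico _ h]
  ring

/-- Writes the best number of unsplit jobs to natural register `16`. -/
def chooseSplit : Program :=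
  .while (.natLt 15 0)
    (.seq (block [.natRead 13 2 17, .realRead 2 0 13, .realAdd 2 2 0, .realAdd 2 5 2,
        .realAdd 5 4 9, .realAdd 4 2 9, .realAdd 7 7 1, .realSub 1 1 0, .realSub 6 4 7,
        .natAdd 15 15 1, .natAdd 17 17 1])
      (.ite (.realLt 6 8) (block [.realAdd 8 6 9, .natAdd 16 15 11]) .skip))

/-- The setup time plus the processing time of the `k`-th job in sorted order. -/
noncomputable def sortedTime (σ : State) (k : ℕ) : ℝ :=
  σ.realReg 0 + σ.realArr 0 (σ.natArr 2 (σ.natReg 4 + k))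

/-- Two consecutive values of `altSum` are kept because its recursion goes back two steps. Real
register `1` counts down from `n * s`, which avoids multiplications. -/
structure ChooseInv (n : ℕ) (σ₀ σ : State) : Prop where
  reg : ∀ r, r ≠ 13 → r ≠ 15 → r ≠ 16 → r ≠ 17 → σ.natReg r = σ₀.natReg r
  natArr : σ.natArr = σ₀.natArr
  realArr : σ.realArr = σ₀.realArr
  real0 : σ.realReg 0 = σ₀.realReg 0
  realHigh : ∀ r, 9 ≤ r → σ.realReg r = σ₀.realReg r
  le : σ.natReg 15 ≤ n
  reg17 : σ.natReg 17 = σ₀.natReg 4 + σ.natReg 15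
  real1 : σ.realReg 1 = σ₀.realReg 0 * ((n : ℝ) - σ.natReg 15)
  real4 : σ.realReg 4 = altSum (sortedTime σ₀) (σ.natReg 15 + 1)
  real5 : σ.realReg 5 = altSum (sortedTime σ₀) (σ.natReg 15)
  real7 : σ.realReg 7 = ∑ k ∈ range (σ.natReg 15), σ₀.realReg 0 * ((n : ℝ) - k)
  best_le : σ.natReg 16 ≤ σ.natReg 15
  real8 : σ.realReg 8 = splitCost n (σ₀.realReg 0) (sortedTime σ₀) (σ.natReg 16)
  best : ∀ K ≤ σ.natReg 15, σ.realReg 8 ≤ splitCost n (σ₀.realReg 0) (sortedTime σ₀) K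

/-- Threshold 0 has `splitCost` zero, so the zeros in the untouched registers already record it as
the best so far. -/
theorem chooseSplit_spec {n : ℕ} {s : ℝ} {arr : ℕ → ℕ → ℝ} {σ : State} {T : ℕ}
    (h : JobsSorted n s arr σ) (hT : 17 * n + 3 ≤ T) :
    Runs (.seq (block [.natAdd 17 4 11]) chooseSplit) σ T fun τ =>
      ChooseInv n σ τ ∧ τ.natReg 15 = n := by
  obtain ⟨⟨a0, a1, a11, ah, b0, bh, ba⟩, b1, -, -⟩ := h
  refine Runs.block_seq (T := 17 * n + 1) (by simp; omega) ?_
  refine (Runs.loop (ChooseInv n σ) (fun τ => 17 * (n - τ.natReg 15)) ?_ ?_ ?_).mono le_rfl ?_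
  · simp only [applyAll, Instr.apply]
    refine ⟨?_, rfl, rfl, rfl, fun _ _ => rfl, ?_, ?_, ?_, ?_, ?_, ?_, ?_, ?_, ?_⟩
    · intro r _ _ _ h17
      simp [h17]
    · simp [ah 15]
    · simp [ah 15, a11]
    · simp [ah 15, b1, b0, mul_comm]
    · simp [ah 15, bh 4, altSum]
    · simp [ah 15, bh 5, altSum]
    · simp [ah 15, bh 7]
    · simp [ah 15, ah 16]
    · simp [ah 16, bh 8, splitCost, altSum]
    · intro K hK
      simp [ah 15] at hK
      simp [hK, bh 8, splitCost, altSum]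
  · simp [applyAll, Instr.apply, ah 15]
  · intro τ h hb
    obtain ⟨g, hV, hA, c0, ch, hle, g17, c1, c4, c5, c7, hbest, c8, hmin⟩ := h
    have g0 : τ.natReg 0 = n := by rw [← a0]; apply g <;> simp
    have g1 : τ.natReg 1 = 1 := (g 1 (by simp) (by simp) (by simp) (by simp)).trans a1
    have g4 : τ.natReg 4 = σ.natReg 4 := by apply g <;> simp
    have g11 : τ.natReg 11 = 0 := by rw [← a11]; apply g <;> simp
    have c9 : τ.realReg 9 = 0 := by rw [ch 9 le_rfl, bh 9 (by omega)]
    have hb' : τ.natReg 15 < n := g0 ▸ hb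
    refine ⟨16, Runs.block_seq (T := 4) (by simp) ?_⟩
    set t := τ.natReg 15 with ht
    set q := sortedTime σ with hq
    have hqt : τ.realArr 0 (τ.natArr 2 (τ.natReg 17)) + τ.realReg 0 = q t := by
      rw [hA, hV, g17, c0, hq, sortedTime, add_comm]
    set υ := applyAll [.natRead 13 2 17, .realRead 2 0 13, .realAdd 2 2 0, .realAdd 2 5 2,
        .realAdd 5 4 9, .realAdd 4 2 9, .realAdd 7 7 1, .realSub 1 1 0, .realSub 6 4 7,
        .natAdd 15 15 1, .natAdd 17 17 1] τ with hυ
    have u : ∀ r, r ≠ 13 → r ≠ 15 → r ≠ 16 → r ≠ 17 → υ.natReg r = σ.natReg r := by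
      intro r h13 h15 h16 h17
      rw [← g r h13 h15 h16 h17]
      simp [hυ, applyAll, Instr.apply, h13, h15, h17]
    have u15 : υ.natReg 15 = t + 1 := by simp [hυ, applyAll, Instr.apply, g1, ht]
    have u16 : υ.natReg 16 = τ.natReg 16 := by simp [hυ, applyAll, Instr.apply]
    have u11 : υ.natReg 11 = 0 := by simp [hυ, applyAll, Instr.apply, g11]
    have u17 : υ.natReg 17 = σ.natReg 4 + (t + 1) := by
      simp [hυ, applyAll, Instr.apply, g1, g17, add_assoc]
    have uV : υ.natArr = σ.natArr := by simp [hυ, applyAll, Instr.apply, hV]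
    have uA : υ.realArr = σ.realArr := by simp [hυ, applyAll, Instr.apply, hA]
    have w0 : υ.realReg 0 = σ.realReg 0 := by simp [hυ, applyAll, Instr.apply, c0]
    have wh : ∀ r, 9 ≤ r → υ.realReg r = σ.realReg r := by
      intro r hr
      rw [← ch r hr]
      simp [hυ, applyAll, Instr.apply, show r ≠ 2 by omega, show r ≠ 5 by omega,
        show r ≠ 4 by omega, show r ≠ 7 by omega, show r ≠ 1 by omega, show r ≠ 6 by omega]
    have w9 : υ.realReg 9 = 0 := by rw [wh 9 le_rfl, bh 9 (by omega)]
    have w1 : υ.realReg 1 = σ.realReg 0 * ((n : ℝ) - ((t + 1 : ℕ) : ℝ)) := by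
      simp [hυ, applyAll, Instr.apply, c1, c0]
      ring
    have w4 : υ.realReg 4 = altSum q (t + 1 + 1) := by
      simp [hυ, applyAll, Instr.apply, c9, hqt, c5, altSum]
    have w5 : υ.realReg 5 = altSum q (t + 1) := by
      simp [hυ, applyAll, Instr.apply, c9, c4]
    have w7 : υ.realReg 7 = ∑ k ∈ range (t + 1), σ.realReg 0 * ((n : ℝ) - k) := by
      rw [sum_range_succ, ← c7, ← c1]
      simp [hυ, applyAll, Instr.apply]
    have w6 : υ.realReg 6 = splitCost n (σ.realReg 0) q (t + 1) := by
      rw [splitCost, ← w7, ← w4]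
      simp [hυ, applyAll, Instr.apply]
    have w8 : υ.realReg 8 = τ.realReg 8 := by simp [hυ, applyAll, Instr.apply]
    refine Runs.ite (T := 3) (fun hlt => ?_) fun hlt => ?_
    · have hlt' : υ.realReg 6 < υ.realReg 8 := hlt
      refine Runs.of_block ?_ (by simp)
      simp only [applyAll, Instr.apply]
      refine ⟨⟨?_, uV, uA, ?_, ?_, ?_, ?_, ?_, ?_, ?_, ?_, ?_, ?_, ?_⟩, ?_⟩
      · intro r h13 h15 h16 h17
        simp [h16, u r h13 h15 h16 h17]
      · simp [w0]
      · intro r hr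
        simp [show r ≠ 8 by omega, wh r hr]
      · simp [u15]; omega
      · simp [u15, u17]
      · simpa [u15] using w1
      · simpa [u15] using w4
      · simp [u15, w5, hq]
      · simpa [u15] using w7
      · simp [u15, u11]
      · simp [u15, u11, w9, w6, hq]
      · intro K hK
        simp [u15, w9] at hK ⊢
        rcases Nat.le_succ_iff.1 hK with hK | rfl
        · exact hlt'.le.trans (w8 ▸ hmin K hK)
        · exact w6.le
      · simp [u15]; omega
    · have hlt' : ¬ υ.realReg 6 < υ.realReg 8 := hlt
      refine ⟨1, υ, by omega, .skip _, ?_⟩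
      refine ⟨⟨u, uV, uA, w0, wh, ?_, ?_, ?_, ?_, ?_, ?_, ?_, ?_, ?_⟩, ?_⟩
      · omega
      · rw [u15, u17]
      · rw [u15, w1]
      · rw [u15, w4]
      · rw [u15, w5]
      · rw [u15, w7]
      · omega
      · rw [w8, c8, u16]
      · intro K hK
        rw [u15] at hK
        rcases Nat.le_succ_iff.1 hK with hK | rfl
        · exact w8 ▸ hmin K hK
        · rw [← w6]
          exact not_lt.1 hlt'
      · omega
  · rintro τ ⟨h, hb⟩
    have g0 : τ.natReg 0 = n := by rw [← a0]; apply h.reg <;> simp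
    have hb' : ¬ τ.natReg 15 < τ.natReg 0 := hb
    have := h.le
    exact ⟨h, by omega⟩

/-! ### The schedule that leaves exactly the first jobs unsplit -/

/-- The list `L` of parts is a schedule for the first `k` of the jobs, in the order `τ`, in which
machine `x` is free from `A` on, machine `y` from `B` on, and the `l`-th job is finished by
`c l`. -/
structure PartialPlan {n : ℕ} (p : Fin n → ℝ) (s : ℝ) (τ : Equiv.Perm (Fin n)) (q : ℕ → ℝ)
    (K k : ℕ) (L : List (Part n 2)) (A B : ℝ) (x y : Fin 2) (c : ℕ → ℝ) : Prop where
  nonneg : 0 ≤ A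
  le : A ≤ B
  ne : x ≠ y
  gap : ∀ l, k ≤ l → l < n → B - A ≤ q l
  start_nonneg : ∀ a ∈ L, 0 ≤ a.start
  length_pos : ∀ a ∈ L, 0 < a.length
  finish_le_left : ∀ a ∈ L, a.machine = x → a.finish s ≤ A
  finish_le_right : ∀ a ∈ L, a.machine = y → a.finish s ≤ B
  disjoint : L.Pairwise fun a b => a.machine = b.machine → a.finish s ≤ b.start
  job_lt : ∀ a ∈ L, ((τ.symm a.job : Fin n) : ℕ) < k
  job_sum : ∀ j, (L.map fun a => if a.job = j then a.length else 0).sum =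
    if ((τ.symm j : Fin n) : ℕ) < k then p j else 0
  finish_le : ∀ a ∈ L, a.finish s ≤ c ((τ.symm a.job : Fin n) : ℕ)
  load : A + B ≤ ∑ l ∈ range k, q l + s * ((k - K : ℕ) : ℝ)
  load_eq : k ≤ K → A + B = ∑ l ∈ range k, q l
  gap_eq : k ≤ K → B - A = altSum q (k + 1) - altSum q k
  cost : 2 * ∑ l ∈ range k, c l ≤ ∑ l ∈ range k, ∑ m ∈ range (l + 1), q m +
    altSum q (min k K + 1) + ∑ l ∈ range k, s * ((l + 1 - K : ℕ) : ℝ)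

namespace PartialPlan

variable {n : ℕ} {p : Fin n → ℝ} {s : ℝ} {τ : Equiv.Perm (Fin n)} {q : ℕ → ℝ} {K k : ℕ}
  {L : List (Part n 2)} {A B : ℝ} {x y : Fin 2} {c : ℕ → ℝ}

theorem init (hs : 0 < s) (hp : ∀ j, 0 < p j) (hq : ∀ k : Fin n, q k = s + p (τ k)) :
    PartialPlan p s τ q K 0 [] 0 0 0 1 fun _ => 0 where
  nonneg := le_rfl
  le := le_rfl
  ne := by simp
  gap := fun l _ hl => by
    have := hq ⟨l, hl⟩
    have := hp (τ ⟨l, hl⟩)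
    simp only [sub_self] at *
    linarith
  start_nonneg := by simp
  length_pos := by simp
  finish_le_left := by simp
  finish_le_right := by simp
  disjoint := List.Pairwise.nil
  job_lt := by simp
  job_sum := by simp
  finish_le := by simp
  load := by simp
  load_eq := by simp
  gap_eq := by simp [altSum]
  cost := by simp [altSum]

theorem congr (h : PartialPlan p s τ q K k L A B x y c) {A' B' : ℝ} (hA : A' = A)
    (hB : B' = B) : PartialPlan p s τ q K k L A' B' x y c := hA ▸ hB ▸ h

theorem job_sum_succ (h : PartialPlan p s τ q K k L A B x y c) (hk : k < n) {M : List (Part n 2)}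
    (hM : ∀ a ∈ M, a.job = τ ⟨k, hk⟩) (hsum : (M.map fun a => a.length).sum = p (τ ⟨k, hk⟩))
    (j : Fin n) :
    ((L ++ M).map fun a => if a.job = j then a.length else 0).sum =
      if ((τ.symm j : Fin n) : ℕ) < k + 1 then p j else 0 := by
  rw [List.map_append, List.sum_append, h.job_sum]
  by_cases hj : j = τ ⟨k, hk⟩
  · have : (M.map fun a => if a.job = j then a.length else 0) = M.map fun a => a.length :=
      List.map_congr_left fun a ha => by rw [hM a ha, hj, if_pos rfl]
    rw [this, hsum, hj]
    simp
  · have : (M.map fun a => if a.job = j then a.length else 0) = M.map fun _ => 0 :=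
      List.map_congr_left fun a ha => by rw [hM a ha, if_neg (Ne.symm hj)]
    rw [this, List.map_const', List.sum_replicate, smul_zero, add_zero]
    have hne : ((τ.symm j : Fin n) : ℕ) ≠ k := fun hjk =>
      hj ((Equiv.symm_apply_eq τ).1 (Fin.ext hjk))
    simp only [Nat.lt_succ_iff_lt_or_eq, hne, or_false]

theorem sum_update (c : ℕ → ℝ) (k : ℕ) (t : ℝ) :
    ∑ l ∈ range (k + 1), Function.update c k t l = ∑ l ∈ range k, c l + t := by
  rw [sum_range_succ, Function.update_self]
  congr 1
  refine sum_congr rfl fun l hl => Function.update_of_ne ?_ _ _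
  rw [mem_range] at hl
  omega

theorem finish_le_update (h : PartialPlan p s τ q K k L A B x y c) (t : ℝ) (a : Part n 2)
    (ha : a ∈ L) : a.finish s ≤ Function.update c k t ((τ.symm a.job : Fin n) : ℕ) := by
  rw [Function.update_of_ne (h.job_lt a ha).ne]
  exact h.finish_le a ha

/-- As the gap is at most `q k`, the job ends no earlier than `B`. The machines swap roles and the
new gap is `q k` minus the old one, which is the recursion of `altSum`. -/
theorem unsplit (h : PartialPlan p s τ q K k L A B x y c) (hk : k < n) (hs : 0 < s)
    (hp : ∀ j, 0 < p j) (hq : ∀ k : Fin n, q k = s + p (τ k))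
    (hmono : ∀ k l, k ≤ l → l < n → q k ≤ q l) (hK : k < K ∨ p (τ ⟨k, hk⟩) ≤ B - A) :
    PartialPlan p s τ q K (k + 1) (L ++ [⟨τ ⟨k, hk⟩, x, A, p (τ ⟨k, hk⟩)⟩]) B
      (A + (s + p (τ ⟨k, hk⟩))) y x (Function.update c k (A + (s + p (τ ⟨k, hk⟩)))) := by
  have hqk := hq ⟨k, hk⟩
  have hpk := hp (τ ⟨k, hk⟩)
  have hgap := h.gap k le_rfl hk
  have hA := h.nonneg
  have hAB := h.le
  have hload := h.load
  simp only at hqk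
  set P := p (τ ⟨k, hk⟩) with hP
  have hmk : ((k - K : ℕ) : ℝ) ≤ ((k + 1 - K : ℕ) : ℝ) := by
    exact_mod_cast (by omega : k - K ≤ k + 1 - K)
  have hsm := mul_le_mul_of_nonneg_left hmk hs.le
  refine ⟨hA.trans hAB, by linarith, h.ne.symm, ?_, ?_, ?_, ?_, ?_, ?_, ?_, ?_, ?_, ?_, ?_, ?_, ?_⟩
  · intro l hl hln
    have := hmono k l (by omega) hln
    linarith
  · simpa [or_imp, forall_and] using ⟨h.start_nonneg, hA⟩
  · simpa [or_imp, forall_and] using ⟨h.length_pos, hpk⟩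
  · simpa [or_imp, forall_and] using ⟨h.finish_le_right, fun hxy => absurd hxy h.ne⟩
  · simp only [List.mem_append, List.mem_singleton]
    rintro a (ha | rfl) hx
    · have := h.finish_le_left a ha hx
      linarith
    · simp only [Part.finish]
      linarith
  · rw [List.pairwise_append]
    refine ⟨h.disjoint, List.pairwise_singleton _ _, ?_⟩
    simp only [List.mem_singleton]
    rintro a ha _ rfl hm
    exact h.finish_le_left a ha hm
  · simp only [List.mem_append, List.mem_singleton]
    rintro a (ha | rfl)
    · exact (h.job_lt a ha).trans (Nat.lt_succ_self k)
    · simp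
  · exact h.job_sum_succ hk (by simp) (by simp [hP])
  · simp only [List.mem_append, List.mem_singleton]
    rintro a (ha | rfl)
    · exact h.finish_le_update _ a ha
    · simp [Part.finish]
      linarith
  · rw [sum_range_succ]
    linarith
  · intro hkK
    have := h.load_eq (by omega)
    rw [sum_range_succ]
    linarith
  · intro hkK
    have := h.gap_eq (by omega)
    rw [altSum]
    linarith
  · rw [sum_update, sum_range_succ, sum_range_succ q, sum_range_succ (fun l => s * _)]
    have hcost := h.cost
    rcases lt_or_ge k K with hkK | hkK
    -- Before the threshold, twice the new completion time is the total load plus the new gap; the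
    -- gaps telescope to `altSum`.
    · have h1 := h.load_eq hkK.le
      have h2 := h.gap_eq hkK.le
      rw [min_eq_left hkK.le] at hcost
      rw [min_eq_left (by omega), altSum, show k + 1 - K = 0 by omega, Nat.cast_zero, mul_zero]
      linarith
    -- From the threshold on, a job that fits into the gap satisfies `2 * (A + s + P) ≤ (A + B + s +
    -- P) + s`, the same bound as for a split job.
    · have h1 : P ≤ B - A := hK.resolve_left (by omega)
      rw [min_eq_right hkK] at hcost
      have hcast : ((k + 1 - K : ℕ) : ℝ) = ((k - K : ℕ) : ℝ) + 1 := by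
        exact_mod_cast (by omega : k + 1 - K = k - K + 1)
      rw [min_eq_right (by omega), hcast]
      linarith

/-- The first length is chosen to make both parts end at `(A + B + P) / 2 + s`, with `P` the
processing time. The second length is `(P - (B - A)) / 2`, which is positive by `hlt`. -/
theorem split (h : PartialPlan p s τ q K k L A B x y c) (hk : k < n) (hs : 0 < s)
    (hp : ∀ j, 0 < p j) (hq : ∀ k : Fin n, q k = s + p (τ k)) (hK : K ≤ k)
    (hlt : B - A < p (τ ⟨k, hk⟩)) :
    PartialPlan p s τ q K (k + 1)
      (L ++ [⟨τ ⟨k, hk⟩, x, A, (p (τ ⟨k, hk⟩) + (B - A)) / 2⟩] ++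
        [⟨τ ⟨k, hk⟩, y, B, p (τ ⟨k, hk⟩) - (p (τ ⟨k, hk⟩) + (B - A)) / 2⟩])
      (A + s + (p (τ ⟨k, hk⟩) + (B - A)) / 2) (A + s + (p (τ ⟨k, hk⟩) + (B - A)) / 2) x y
      (Function.update c k (A + s + (p (τ ⟨k, hk⟩) + (B - A)) / 2)) := by
  have hqk := hq ⟨k, hk⟩
  have hpk := hp (τ ⟨k, hk⟩)
  have hA := h.nonneg
  have hAB := h.le
  have hload := h.load
  simp only at hqk
  set P := p (τ ⟨k, hk⟩) with hP
  have hcast : ((k + 1 - K : ℕ) : ℝ) = ((k - K : ℕ) : ℝ) + 1 := by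
    exact_mod_cast (by omega : k + 1 - K = k - K + 1)
  rw [List.append_assoc, List.singleton_append]
  refine ⟨by linarith, le_rfl, h.ne, ?_, ?_, ?_, ?_, ?_, ?_, ?_, ?_, ?_, ?_, ?_, ?_, ?_⟩
  · intro l hl hln
    have h1 := hq ⟨l, hln⟩
    have h2 := hp (τ ⟨l, hln⟩)
    simp only at h1
    linarith
  · simp only [List.mem_append, List.mem_cons, List.not_mem_nil, or_false]
    rintro a (ha | rfl | rfl)
    · exact h.start_nonneg a ha
    · exact hA
    · exact hA.trans hAB
  · simp only [List.mem_append, List.mem_cons, List.not_mem_nil, or_false]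
    rintro a (ha | rfl | rfl)
    · exact h.length_pos a ha
    · show 0 < (P + (B - A)) / 2
      linarith
    · show 0 < P - (P + (B - A)) / 2
      linarith
  · simp only [List.mem_append, List.mem_cons, List.not_mem_nil, or_false]
    rintro a (ha | rfl | rfl) hx
    · have := h.finish_le_left a ha hx
      linarith
    · exact le_rfl
    · exact absurd hx.symm h.ne
  · simp only [List.mem_append, List.mem_cons, List.not_mem_nil, or_false]
    rintro a (ha | rfl | rfl) hx
    · have := h.finish_le_right a ha hx
      linarith
    · exact le_rfl
    · simp only [Part.finish]
      linarith
  · rw [List.pairwise_append]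
    refine ⟨h.disjoint, ?_, ?_⟩
    · rw [List.pairwise_pair]
      exact fun hxy => absurd hxy h.ne
    · simp only [List.mem_cons, List.not_mem_nil, or_false]
      rintro a ha _ (rfl | rfl) hm
      · exact h.finish_le_left a ha hm
      · exact h.finish_le_right a ha hm
  · simp only [List.mem_append, List.mem_cons, List.not_mem_nil, or_false]
    rintro a (ha | rfl | rfl)
    · exact (h.job_lt a ha).trans (Nat.lt_succ_self k)
    · simp
    · simp
  · exact h.job_sum_succ hk (by simp) (by simp [hP])
  · simp only [List.mem_append, List.mem_cons, List.not_mem_nil, or_false]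
    rintro a (ha | rfl | rfl)
    · exact h.finish_le_update _ a ha
    · simp [Part.finish]
    · simp [Part.finish]
      linarith
  · rw [sum_range_succ, hcast]
    linarith
  · intro hkK
    omega
  · intro hkK
    omega
  · rw [sum_update, sum_range_succ, sum_range_succ q, sum_range_succ (fun l => s * _)]
    have hcost := h.cost
    rw [min_eq_right hK] at hcost
    rw [min_eq_right (by omega), hcast]
    linarith

end PartialPlan

/-- The schedule that consists of the parts in a list. -/
def Schedule.ofList {n m : ℕ} (L : List (Part n m)) : Schedule n m := ⟨L.length, L.get⟩

/-! ### A complete plan is an optimal schedule. -/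

namespace PartialPlan

variable {n : ℕ} {p : Fin n → ℝ} {s : ℝ} {τ : Equiv.Perm (Fin n)} {q : ℕ → ℝ} {K : ℕ}
  {L : List (Part n 2)} {A B : ℝ} {x y : Fin 2} {c : ℕ → ℝ}

theorem isFeasible (h : PartialPlan p s τ q K n L A B x y c) :
    (Schedule.ofList L).IsFeasible p s where
  start_nonneg := fun a => h.start_nonneg _ (List.get_mem _ _)
  length_pos := fun a => h.length_pos _ (List.get_mem _ _)
  no_overlap := by
    have hpw := List.pairwise_iff_get.1 h.disjoint
    intro a b hab hm
    rcases lt_or_gt_of_ne hab with hlt | hlt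
    · exact Or.inl (hpw a b hlt hm)
    · exact Or.inr (hpw b a hlt hm.symm)
  complete := fun j => by
    have hj := h.job_sum j
    rw [if_pos (Fin.is_lt _)] at hj
    rw [← hj, sum_filter]
    exact (Fin.sum_univ_fun_getElem L fun a => if a.job = j then a.length else 0)

theorem totalCompletionTime_le (h : PartialPlan p s τ q K n L A B x y c) (hp : ∀ j, 0 < p j) :
    (Schedule.ofList L).totalCompletionTime s ≤ ∑ l ∈ range n, c l := by
  rw [← Fin.sum_univ_eq_sum_range, ← Equiv.sum_comp τ.symm, Schedule.totalCompletionTime]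
  refine sum_le_sum fun j _ => ?_
  -- `ciSup_le` needs a nonempty index type; positive processing times provide a part.
  obtain ⟨a, ha⟩ := card_pos.1 (h.isFeasible.parts_nonempty hp j)
  have : Nonempty {a : Fin (Schedule.ofList L).numParts // ((Schedule.ofList L).part a).job = j} :=
    ⟨a, (mem_filter.1 ha).2⟩
  refine ciSup_le ?_
  rintro ⟨a, rfl⟩
  exact h.finish_le _ (List.get_mem _ _)

/-- The upper bound from `cost` and the lower bound for any competitor are the same function of the
threshold, and `K` minimises it. -/
theorem isOptimal (h : PartialPlan p s τ q K n L A B x y c) (hs : 0 < s) (hp : ∀ j, 0 < p j)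
    (hq : ∀ k : Fin n, q k = s + p (τ k)) (hmono : ∀ k l, k ≤ l → l < n → q k ≤ q l)
    (hK : K ≤ n) (hbest : ∀ K' ≤ n, altSum q (K + 1) + ∑ k ∈ Ico K n, s * ((n : ℝ) - k) ≤
      altSum q (K' + 1) + ∑ k ∈ Ico K' n, s * ((n : ℝ) - k)) :
    (Schedule.ofList L).IsOptimal p s := by
  refine ⟨h.isFeasible, fun S' hS' => ?_⟩
  obtain ⟨K', hK', hle⟩ := hS'.exists_le_two_mul_totalCompletionTime hs hp τ q hq hmono
  have h1 := h.totalCompletionTime_le hp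
  have h2 := h.cost
  rw [sum_range_sum_range_succ, min_eq_right hK, sum_range_sub_eq s hK] at h2
  have h3 := hbest K' hK'
  linarith

end PartialPlan

/-! ### Writing the schedule -/

/-- The four arrays describe the parts in the list `L`. -/
def Describes {n m : ℕ} (job machine : ℕ → ℕ) (start length : ℕ → ℝ) (L : List (Part n m)) : Prop :=
  ∀ (i : ℕ) (hi : i < L.length), job i = L[i].job ∧ machine i = L[i].machine ∧
    start i = L[i].start ∧ length i = L[i].length

theorem Describes.append {n m : ℕ} {job machine : ℕ → ℕ} {start length : ℕ → ℝ}
    {L : List (Part n m)} (h : Describes job machine start length L) (a : Part n m) :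
    Describes (Function.update job L.length a.job) (Function.update machine L.length a.machine)
      (Function.update start L.length a.start) (Function.update length L.length a.length)
      (L ++ [a]) := by
  intro i hi
  rw [List.length_append, List.length_singleton] at hi
  rcases Nat.lt_succ_iff_lt_or_eq.1 hi with hi | rfl
  · simpa [hi, hi.ne] using h i hi
  · simp

/-- Appends a part that consists of a whole job, on the machine that is free first. -/
def placeUnsplit : Program :=
  block [.natWrite 0 19 13, .natWrite 1 19 20, .realWrite 1 19 10, .realWrite 2 19 2,
    .natAdd 19 19 1, .realAdd 2 2 0, .realAdd 2 10 2, .realAdd 10 11 9, .realAdd 11 2 9,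
    .natAdd 22 20 11, .natAdd 20 21 11, .natAdd 21 22 11]

/-- Appends two parts of a job that are finished at the same time. -/
def placeSplit : Program :=
  block [.realAdd 12 2 3, .realHalf 12 12, .realSub 13 2 12, .natWrite 0 19 13, .natWrite 1 19 20,
    .realWrite 1 19 10, .realWrite 2 19 12, .natAdd 19 19 1, .natWrite 0 19 13, .natWrite 1 19 21,
    .realWrite 1 19 11, .realWrite 2 19 13, .natAdd 19 19 1, .realAdd 10 10 0, .realAdd 10 10 12,
    .realAdd 11 10 9]

def placeJobs : Program :=
  .while (.natLt 18 0)
    (.seq (block [.natRead 13 2 17, .realRead 2 0 13, .realSub 3 11 10, .natAdd 17 17 1,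
        .natAdd 18 18 1])
      (.ite (.natLt 16 18) (.ite (.realLt 3 2) placeSplit placeUnsplit) placeUnsplit))

/-- The invariant of `placeJobs`, except that `k` jobs have been placed. -/
structure PlaceInv {n : ℕ} (p : Fin n → ℝ) (s : ℝ) (τ : Equiv.Perm (Fin n)) (q : ℕ → ℝ)
    (K i k : ℕ) (σ : State) : Prop where
  reg0 : σ.natReg 0 = n
  reg1 : σ.natReg 1 = 1
  reg11 : σ.natReg 11 = 0
  reg16 : σ.natReg 16 = K
  reg17 : σ.natReg 17 = i + σ.natReg 18
  real0 : σ.realReg 0 = s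
  real9 : σ.realReg 9 = 0
  order : ∀ k : Fin n, σ.natArr 2 (i + k) = τ k
  times : ∀ j : Fin n, σ.realArr 0 j = p j
  plan : ∃ (L : List (Part n 2)) (x y : Fin 2) (c : ℕ → ℝ),
    PartialPlan p s τ q K k L (σ.realReg 10) (σ.realReg 11) x y c ∧ σ.natReg 19 = L.length ∧
      σ.natReg 20 = x ∧ σ.natReg 21 = y ∧
      Describes (σ.natArr 0) (σ.natArr 1) (σ.realArr 1) (σ.realArr 2) L

section

variable {n : ℕ} {p : Fin n → ℝ} {s : ℝ} {τ : Equiv.Perm (Fin n)} {q : ℕ → ℝ} {K i : ℕ}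

theorem placeUnsplit_spec {σ : State} {k : ℕ} (h : PlaceInv p s τ q K i k σ) (hk : k < n)
    (hs : 0 < s) (hp : ∀ j, 0 < p j) (hq : ∀ k : Fin n, q k = s + p (τ k))
    (hmono : ∀ k l, k ≤ l → l < n → q k ≤ q l) (h13 : σ.natReg 13 = τ ⟨k, hk⟩)
    (h2 : σ.realReg 2 = p (τ ⟨k, hk⟩))
    (hK : k < K ∨ p (τ ⟨k, hk⟩) ≤ σ.realReg 11 - σ.realReg 10) :
    Runs placeUnsplit σ 17 fun υ =>
      PlaceInv p s τ q K i (k + 1) υ ∧ υ.natReg 18 = σ.natReg 18 := by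
  obtain ⟨a0, a1, a11, a16, a17, b0, b9, hV, hP, L, x, y, c, hL, h19, h20, h21, hD⟩ := h
  refine Runs.of_block ?_ (by simp)
  simp only [applyAll, Instr.apply]
  refine ⟨⟨?_, ?_, ?_, ?_, ?_, ?_, ?_, ?_, ?_, ?_⟩, ?_⟩
  · simp [a0]
  · simp [a1]
  · simp [a11]
  · simp [a16]
  · simp [a17]
  · simp [b0]
  · simp [b9]
  · intro k
    simpa using hV k
  · intro j
    simpa using hP j
  · refine ⟨_, y, x, _, hL.unsplit hk hs hp hq hmono hK |>.congr ?_ ?_, ?_, ?_, ?_, ?_⟩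
    · simp [b9]
    · simp [b9, h2, b0, add_comm]
    · simp [h19, a1]
    · simp [h21, a11]
    · simp [h20, a11]
    · simpa [h19, h13, h20, h2] using hD.append ⟨τ ⟨k, hk⟩, x, σ.realReg 10, p (τ ⟨k, hk⟩)⟩
  · simp

theorem placeSplit_spec {σ : State} {k : ℕ} (h : PlaceInv p s τ q K i k σ) (hk : k < n)
    (hs : 0 < s) (hp : ∀ j, 0 < p j) (hq : ∀ k : Fin n, q k = s + p (τ k))
    (h13 : σ.natReg 13 = τ ⟨k, hk⟩) (h2 : σ.realReg 2 = p (τ ⟨k, hk⟩))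
    (h3 : σ.realReg 3 = σ.realReg 11 - σ.realReg 10) (hK : K ≤ k)
    (hlt : σ.realReg 11 - σ.realReg 10 < p (τ ⟨k, hk⟩)) :
    Runs placeSplit σ 17 fun υ =>
      PlaceInv p s τ q K i (k + 1) υ ∧ υ.natReg 18 = σ.natReg 18 := by
  obtain ⟨a0, a1, a11, a16, a17, b0, b9, hV, hP, L, x, y, c, hL, h19, h20, h21, hD⟩ := h
  refine Runs.of_block ?_ (by simp)
  simp only [applyAll, Instr.apply]
  refine ⟨⟨?_, ?_, ?_, ?_, ?_, ?_, ?_, ?_, ?_, ?_⟩, ?_⟩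
  · simp [a0]
  · simp [a1]
  · simp [a11]
  · simp [a16]
  · simp [a17]
  · simp [b0]
  · simp [b9]
  · intro k
    simpa using hV k
  · intro j
    simpa using hP j
  · refine ⟨_, x, y, _, hL.split hk hs hp hq hK hlt |>.congr ?_ ?_, ?_, ?_, ?_, ?_⟩
    · simp [h2, h3, b0]
    · simp [b9, h2, h3, b0]
    · simp [h19, a1]
    · simp [h20]
    · simp [h21]
    · have := (hD.append ⟨τ ⟨k, hk⟩, x, σ.realReg 10,
        (p (τ ⟨k, hk⟩) + (σ.realReg 11 - σ.realReg 10)) / 2⟩).append ⟨τ ⟨k, hk⟩, y, σ.realReg 11,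
          p (τ ⟨k, hk⟩) - (p (τ ⟨k, hk⟩) + (σ.realReg 11 - σ.realReg 10)) / 2⟩
      simpa [h19, h13, h20, h21, h2, h3, a1] using this
  · simp

/-- Register `18` is incremented before the job is placed, which is why `PlaceInv` has a separate
`k`; the test `K < k + 1` thus means `K ≤ k`. -/
theorem placeJobs_spec {σ : State} {T : ℕ} (h : PlaceInv p s τ q K i 0 σ) (h18 : σ.natReg 18 = 0)
    (hs : 0 < s) (hp : ∀ j, 0 < p j) (hq : ∀ k : Fin n, q k = s + p (τ k))
    (hmono : ∀ k l, k ≤ l → l < n → q k ≤ q l) (hT : 26 * n + 1 ≤ T) :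
    Runs placeJobs σ T (PlaceInv p s τ q K i n) := by
  refine (Runs.loop (fun υ => PlaceInv p s τ q K i (υ.natReg 18) υ ∧ υ.natReg 18 ≤ n)
    (fun υ => 26 * (n - υ.natReg 18)) ⟨h18 ▸ h, by omega⟩ (by rw [h18]; omega) ?_).mono le_rfl ?_
  · rintro σ ⟨h, hle⟩ hb
    have hb' : σ.natReg 18 < σ.natReg 0 := hb
    have hk : σ.natReg 18 < n := h.reg0 ▸ hb'
    set k := σ.natReg 18 with hkdef
    refine ⟨25, Runs.block_seq (T := 19) (by simp) ?_⟩
    set υ := applyAll [.natRead 13 2 17, .realRead 2 0 13, .realSub 3 11 10, .natAdd 17 17 1,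
        .natAdd 18 18 1] σ with hυ
    have h17 := h.reg17
    have h13 : υ.natReg 13 = τ ⟨k, hk⟩ := by
      simp [hυ, applyAll, Instr.apply, h17, ← h.order, hkdef]
    have h2 : υ.realReg 2 = p (τ ⟨k, hk⟩) := by
      rw [← h.times, ← h13]
      simp [hυ, applyAll, Instr.apply]
    have h3 : υ.realReg 3 = υ.realReg 11 - υ.realReg 10 := by simp [hυ, applyAll, Instr.apply]
    have u18 : υ.natReg 18 = k + 1 := by simp [hυ, applyAll, Instr.apply, h.reg1, hkdef]
    have hI : PlaceInv p s τ q K i k υ := by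
      obtain ⟨a0, a1, a11, a16, a17, b0, b9, hV, hP, L, x, y, c, hL, h19, h20, h21, hD⟩ := h
      refine ⟨?_, ?_, ?_, ?_, ?_, ?_, ?_, ?_, ?_, L, x, y, c, ?_, ?_, ?_, ?_, ?_⟩ <;>
        simp [applyAll, Instr.apply, *]
      · omega
      · exact hL
    have u16 := hI.reg16
    have fin : ∀ ω, PlaceInv p s τ q K i (k + 1) ω ∧ ω.natReg 18 = υ.natReg 18 →
        (PlaceInv p s τ q K i (ω.natReg 18) ω ∧ ω.natReg 18 ≤ n) ∧
          25 + 1 + 26 * (n - ω.natReg 18) ≤ 26 * (n - k) := by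
      rintro ω ⟨hω, hω'⟩
      rw [hω', u18]
      exact ⟨⟨hω, hk⟩, by omega⟩
    refine Runs.ite (T := 18) (fun hK => ?_) fun hK => ?_
    · have hK' : υ.natReg 16 < υ.natReg 18 := hK
      refine Runs.ite (T := 17) (fun hlt => ?_) fun hlt => ?_
      · have hlt' : υ.realReg 3 < υ.realReg 2 := hlt
        rw [h3, h2] at hlt'
        exact (placeSplit_spec hI hk hs hp hq h13 h2 h3 (by omega) hlt').mono le_rfl fin
      · have hlt' : ¬ υ.realReg 3 < υ.realReg 2 := hlt
        rw [h3, h2, not_lt] at hlt'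
        exact (placeUnsplit_spec hI hk hs hp hq hmono h13 h2 (Or.inr hlt')).mono le_rfl fin
    · have hK' : ¬ υ.natReg 16 < υ.natReg 18 := hK
      exact (placeUnsplit_spec hI hk hs hp hq hmono h13 h2 (Or.inl (by omega))).mono (by omega) fin
  · rintro υ ⟨⟨h, hle⟩, hb⟩
    have hb' : ¬ υ.natReg 18 < υ.natReg 0 := hb
    rw [h.reg0] at hb'
    rwa [show υ.natReg 18 = n by omega] at h

end

/-! ### The algorithm -/

def scheduleJobs : Program :=
  .seq sortJobs
    (.seq (.seq (block [.natAdd 17 4 11]) chooseSplit)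
      (.seq (block [.natAdd 17 4 11, .natConst 21 1]) (.seq placeJobs (block [.natAdd 0 19 11]))))

/-! ### Correctness and running time of the whole program. -/

theorem exists_perm_of_seg_perm_range {n : ℕ} {V : ℕ → ℕ} {i o : ℕ}
    (h : (seg V i o).Perm (List.range n)) :
    ∃ τ : Equiv.Perm (Fin n), ∀ k : Fin n, V (i + k) = τ k := by
  have hlen : o - i = n := by rw [← length_seg (V := V), h.length_eq, List.length_range]
  have hget : ∀ k (hk : k < (seg V i o).length), (seg V i o)[k] = V (i + k) := by
    intro k hk
    simp [seg]
  have hlt : ∀ k : Fin n, V (i + k) < n := fun k => by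
    have hk : (k : ℕ) < (seg V i o).length := by rw [length_seg, hlen]; exact k.2
    rw [← hget k hk, ← List.mem_range, ← h.mem_iff]
    exact List.getElem_mem hk
  have hinj : Function.Injective fun k : Fin n => (⟨V (i + k), hlt k⟩ : Fin n) := by
    intro k l hkl
    have hk : (k : ℕ) < (seg V i o).length := by rw [length_seg, hlen]; exact k.2
    have hl : (l : ℕ) < (seg V i o).length := by rw [length_seg, hlen]; exact l.2
    have hkl' : V (i + k) = V (i + l) := congrArg Fin.val hkl
    rw [← hget k hk, ← hget l hl] at hkl'
    exact Fin.ext ((h.nodup_iff.2 List.nodup_range).getElem_inj_iff.1 hkl')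
  exact ⟨Equiv.ofBijective _ (Finite.injective_iff_bijective.1 hinj), fun k => rfl⟩

theorem KeySorted.le {f : ℕ → ℝ} {V : ℕ → ℕ} {i o k l : ℕ} (h : KeySorted f (seg V i o))
    (hkl : k ≤ l) (hl : l < o - i) : f (V (i + k)) ≤ f (V (i + l)) := by
  rcases hkl.eq_or_lt with rfl | hlt
  · exact le_rfl
  · have := List.pairwise_iff_getElem.1 h k l (by rw [length_seg]; omega)
      (by rw [length_seg]; omega) hlt
    simpa [seg] using this

theorem scheduleJobs_spec {n : ℕ} (p : Fin n → ℝ) (s : ℝ) (hp : ∀ j, 0 < p j) (hs : 0 < s) {T : ℕ}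
    (hT : 14 * (n * Nat.log 2 (2 * n)) + 63 * n + 16 ≤ T) :
    Runs scheduleJobs (inputState p s) T fun σ =>
      ∃ S : Schedule n 2, Outputs σ S ∧ S.IsOptimal p s := by
  refine (Runs.seq (U := 43 * n + 9) ((sortJobs_spec p s le_rfl).mono le_rfl ?_)).mono
    (by omega) fun _ => id
  intro σ hσ
  refine (Runs.seq (U := 26 * n + 6) ((chooseSplit_spec hσ le_rfl).mono le_rfl ?_)).mono
    (by omega) fun _ => id
  rintro υ ⟨hυ, h15⟩
  obtain ⟨⟨a0, a1, a11, ah, b0, bh, ba⟩, -, hperm, hsorted⟩ := hσ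
  obtain ⟨τ, hτ⟩ := exists_perm_of_seg_perm_range hperm
  have hlen : σ.natReg 8 - σ.natReg 4 = n := by
    rw [← length_seg (V := σ.natArr 2), hperm.length_eq, List.length_range]
  have harr : ∀ j : Fin n, σ.realArr 0 j = p j := fun j => by simp [ba, inputState]
  set q := sortedTime σ with hqdef
  have hq : ∀ k : Fin n, q k = s + p (τ k) := fun k => by
    rw [hqdef, sortedTime, b0, hτ, harr]
  have hmono : ∀ k l, k ≤ l → l < n → q k ≤ q l := fun k l hkl hl => by
    rw [hqdef, sortedTime, sortedTime, ba]
    exact add_le_add le_rfl (hsorted.le hkl (by omega))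
  refine Runs.block_seq (T := 26 * n + 3) (by simp; omega) ?_
  refine (Runs.seq (T := 26 * n + 1) (U := 2) ((placeJobs_spec (p := p) (s := s) (τ := τ) (q := q)
    (K := υ.natReg 16) (i := σ.natReg 4) ?_ ?_ hs hp hq hmono le_rfl).mono le_rfl ?_)).mono
      (by omega) fun _ => id
  · have r0 : υ.natReg 0 = n := (hυ.reg 0 (by simp) (by simp) (by simp) (by simp)).trans a0
    have r1 : υ.natReg 1 = 1 := (hυ.reg 1 (by simp) (by simp) (by simp) (by simp)).trans a1
    have r4 : υ.natReg 4 = σ.natReg 4 := hυ.reg 4 (by simp) (by simp) (by simp) (by simp)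
    have r11 : υ.natReg 11 = 0 := (hυ.reg 11 (by simp) (by simp) (by simp) (by simp)).trans a11
    have rh : ∀ r, 18 ≤ r → υ.natReg r = 0 := fun r hr =>
      (hυ.reg r (by omega) (by omega) (by omega) (by omega)).trans (ah r (by omega))
    have wh : ∀ r, 9 ≤ r → υ.realReg r = 0 := fun r hr =>
      (hυ.realHigh r hr).trans (bh r (by omega))
    simp only [applyAll, Instr.apply]
    refine ⟨?_, ?_, ?_, ?_, ?_, ?_, ?_, ?_, ?_, [], 0, 1, fun _ => 0, ?_, ?_, ?_, ?_, ?_⟩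
    · simp [r0]
    · simp [r1]
    · simp [r11]
    · simp
    · simp [r4, r11, rh 18]
    · rw [hυ.real0, b0]
    · exact wh 9 le_rfl
    · intro k
      rw [← hτ, hυ.natArr]
    · intro j
      rw [← harr, hυ.realArr]
    · rw [wh 10 (by omega), wh 11 (by omega)]
      exact PartialPlan.init hs hp hq
    · simp [rh 19]
    · simp [rh 20]
    · simp
    · intro i hi
      simp at hi
  · have : υ.natReg 18 = 0 :=
      (hυ.reg 18 (by simp) (by simp) (by simp) (by simp)).trans (ah 18 (by omega))
    simp [applyAll, Instr.apply, this]
  · intro ω hω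
    refine Runs.of_block ?_ (by simp)
    obtain ⟨L, x, y, c, hL, h19, -, -, hD⟩ := hω.plan
    refine ⟨Schedule.ofList L, ⟨?_, ?_, ?_, ?_, ?_⟩, ?_⟩
    · simp [applyAll, Instr.apply, hω.reg11, h19, Schedule.ofList]
    · exact fun a => (hD a a.2).1
    · exact fun a => (hD a a.2).2.1
    · exact fun a => (hD a a.2).2.2.1
    · exact fun a => (hD a a.2).2.2.2
    · have hK := hυ.best_le
      rw [h15] at hK
      refine hL.isOptimal hs hp hq hmono hK fun K' hK' => ?_
      rw [← splitCost_add_sum hK, ← splitCost_add_sum hK']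
      have := hυ.best K' (by omega)
      rw [hυ.real8, b0] at this
      exact add_le_add this le_rfl

/-- For `n ≥ 2`, `log (2 * n) ≤ 2 * log n` and `log n / log 2 ≥ 1`, so the linear and constant terms
are absorbed into `n * log n`. -/
theorem isBigO_time : (fun n : ℕ => ((14 * (n * Nat.log 2 (2 * n)) + 63 * n + 16 : ℕ) : ℝ))
    =O[Filter.atTop] fun n : ℕ => (n : ℝ) * Real.log n := by
  refine Asymptotics.IsBigO.of_bound (14 * (2 / Real.log 2) + 63 / Real.log 2 + 16 / Real.log 2) ?_
  filter_upwards [Filter.eventually_ge_atTop 2] with n hn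
  have h2 : 0 < Real.log 2 := Real.log_pos (by norm_num)
  have hn' : (2 : ℝ) ≤ n := by exact_mod_cast hn
  have hlog : Real.log 2 ≤ Real.log n := Real.log_le_log (by norm_num) hn'
  have h1 : (Nat.log 2 (2 * n) : ℝ) ≤ 2 * Real.log n / Real.log 2 := by
    refine (Real.natLog_le_logb _ _).trans ?_
    rw [Real.logb]
    push_cast
    rw [Real.log_mul (by norm_num) (by linarith)]
    gcongr
    linarith
  have h3 : 1 ≤ Real.log n / Real.log 2 := (one_le_div h2).2 hlog
  rw [Real.norm_of_nonneg (by positivity), Real.norm_of_nonneg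
    (mul_nonneg (by linarith) (by linarith))]
  push_cast
  have e1 : (n : ℝ) * Nat.log 2 (2 * n) ≤ n * (2 * Real.log n / Real.log 2) :=
    mul_le_mul_of_nonneg_left h1 (by linarith)
  have e2 : (n : ℝ) * 1 ≤ n * (Real.log n / Real.log 2) :=
    mul_le_mul_of_nonneg_left h3 (by linarith)
  calc 14 * ((n : ℝ) * Nat.log 2 (2 * n)) + 63 * n + 16
      ≤ 14 * (n * (2 * Real.log n / Real.log 2)) + 63 * (n * (Real.log n / Real.log 2)) +
          16 * (n * (Real.log n / Real.log 2)) := by linarith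
    _ = _ := by ring

end SplitScheduling

theorem theorem1 :
    ∃ (c : SplitScheduling.Program) (T : ℕ → ℕ),
      (fun n : ℕ => (T n : ℝ)) =O[Filter.atTop] (fun n : ℕ => (n : ℝ) * Real.log (n : ℝ)) ∧
      ∀ (n : ℕ) (p : Fin n → ℝ) (s : ℝ), (∀ j, 0 < p j) → 0 < s →
        ∃ (t : ℕ) (σ : SplitScheduling.State),
          t ≤ T n ∧
          SplitScheduling.Exec c (SplitScheduling.inputState p s) t σ ∧
          ∃ S : SplitScheduling.Schedule n 2,
            SplitScheduling.Outputs σ S ∧ S.IsOptimal p s :=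
  ⟨SplitScheduling.scheduleJobs, _, SplitScheduling.isBigO_time,
    fun _ p s hp hs => SplitScheduling.scheduleJobs_spec p s hp hs le_rfl⟩
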